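/- Let $(M,g)$ be a connected closed Riemannian manifold of dimension $d\ge 2$, let $T'M=T^*M\setminus\{0\}$, and let $h(x,\xi)=\left(g^{\alpha\beta}(x)\,\xi_\alpha\xi_\beta\right)^{1/2}$ (Einstein's summation convention is used throughout). Let $(x^*(t;y,\eta),\xi^*(t;y,\eta))$, $t\in\mathbb R$, $(y,\eta)\in T'M$, be the cogeodesic flow, i.e. the global solution of Hamilton's equations $\dot x^*=h_\xi(x^*,\xi^*)$, $\dot\xi^*=-h_x(x^*,\xi^*)$ with $(x^*,\xi^*)|_{t=0}=(y,\eta)$. Let $\epsilon>0$ and let $\varphi=\varphi(t,x;y,\eta;\epsilon)$ be the Levi-Civita phase function: an infinitely smooth complex-valued function on $\mathbb R\times M\times T'M$ with $\operatorname{Im}\varphi\ge 0$ which, for $x$ in a neighbourhood of $x^*=x^*(t;y,\eta)$, is given by $$\varphi(t,x;y,\eta;\epsilon)=\int_\gamma\zeta\,\mathrm dz+\frac{\mathrm i\,\epsilon}{2}\,h(y,\eta)\,\operatorname{dist}^2(x,x^*),$$ where $\gamma$ is the shortest geodesic from $x^*$ to $x$, $\zeta$ is the parallel transport of $\xi^*(t;y,\eta)$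 along $\gamma$, and $\operatorname{dist}$ is the Riemannian distance. Fix $t\in\mathbb R$ and $(y,\eta)\in T'M$. In arbitrary local coordinates $x$ near $x^*(t;y,\eta)$ and arbitrary local coordinates near $y$, with $\eta_\mu$ the induced coordinates on $T^*_yM$, put $$q^{\alpha\mu}=\frac{\partial (x^*)^\alpha}{\partial\eta_\mu},\qquad p^{\alpha\mu}=g^{\alpha\gamma}(x^*)\left[\frac{\partial\xi^*_\gamma}{\partial\eta_\mu}-\Gamma^\rho{}_{\gamma\beta}(x^*)\,\xi^*_\rho\,\frac{\partial (x^*)^\beta}{\partial\eta_\mu}\right],$$ where $\Gamma^\rho{}_{\gamma\beta}$ are the Christoffel symbols of $g$. Then all the derivatives involved exist, and $$\left.\varphi_{x^\alpha\eta_\mu}\right|_{x=x^*}=g_{\alpha\beta}(x^*)\left[p^{\beta\mu}-\mathrm i\,\epsilon\,h(y,\eta)\,q^{\beta\mu}\right]$$ for all $\alpha,\mu\in\{1,\dots,d\}$. -/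

import Mathlib

open Bundle Manifold Filter Topology Matrix
open scoped ContDiff

noncomputable section

namespace LeviCivitaPhase

/-- The model space `ℝ^d`. -/
abbrev Model (d : ℕ) : Type := EuclideanSpace ℝ (Fin d)

/-- The cotangent space `T*_x M`, as a fibre of Mathlib's bundle of continuous linear maps from
the tangent bundle to the trivial line bundle. -/
abbrev Cotangent (d : ℕ) {M : Type*} [TopologicalSpace M] [ChartedSpace (Model d) M]
    (x : M) : Type :=
  TangentSpace 𝓘(ℝ, Model d) x →L[ℝ] Bundle.Trivial M ℝ x

/-- The cotangent bundle `T*M`; a point is a pair `⟨x, ξ⟩` with `ξ` in `T*_x M`. -/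
abbrev CotangentBundle (d : ℕ) (M : Type*) [TopologicalSpace M] [ChartedSpace (Model d) M] :
    Type _ :=
  TotalSpace (Model d →L[ℝ] ℝ) (fun x : M => Cotangent d x)

section Coordinates

variable {d : ℕ} {M : Type*} [TopologicalSpace M] [ChartedSpace (Model d) M]

/-- The pairing of a covector and a tangent vector. -/
def pairing {x : M} (ξ : Cotangent d x) (v : TangentSpace 𝓘(ℝ, Model d) x) : ℝ := ξ v

/-- The partial derivative `∂f/∂u^α` of a function of the coordinates `u ∈ ℝ^d`. -/
def partialD {F : Type*} [NormedAddCommGroup F] [NormedSpace ℝ F]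
    (f : Model d → F) (α : Fin d) (u : Model d) : F :=
  lineDeriv ℝ f u (EuclideanSpace.single α 1)

/-- The coordinate vector `∂/∂x^α` at `x`, for the local coordinates given by the chart `e`. -/
def coordVec (e : OpenPartialHomeomorph M (Model d)) (x : M) (α : Fin d) :
    TangentSpace 𝓘(ℝ, Model d) x :=
  (mfderiv 𝓘(ℝ, Model d) 𝓘(ℝ, Model d) e x).inverse (EuclideanSpace.single α (1 : ℝ) : Model d)

/-- The coordinate covector `dx^μ` at `x`, for the local coordinates given by the chart `e`. -/
def coordCovec (e : OpenPartialHomeomorph M (Model d)) (x : M) (μ : Fin d) : Cotangent d x :=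
  (EuclideanSpace.proj μ : Model d →L[ℝ] ℝ).comp
    (mfderiv 𝓘(ℝ, Model d) 𝓘(ℝ, Model d) e x : TangentSpace 𝓘(ℝ, Model d) x →L[ℝ] Model d)

/-- The components `ξ_α` of the covector `ξ` at the point `x`, where `p = ⟨x, ξ⟩`. -/
def momCoord (e : OpenPartialHomeomorph M (Model d)) (p : CotangentBundle d M) (α : Fin d) : ℝ :=
  pairing p.2 (coordVec e p.proj α)

/-- The velocity `γ̇(s)` of a curve in `M`. -/
def velocity (γ : ℝ → M) (s : ℝ) : TangentSpace 𝓘(ℝ, Model d) (γ s) :=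
  mfderiv 𝓘(ℝ, ℝ) 𝓘(ℝ, Model d) γ s (1 : ℝ)

end Coordinates

section Riemannian

variable {d : ℕ} {M : Type*} [MetricSpace M] [ChartedSpace (Model d) M]
  [RiemannianBundle (fun x : M => TangentSpace 𝓘(ℝ, Model d) x)]

/-- The components `g_{αβ}` of the metric, as functions of the coordinates `u`. -/
def gLow (e : OpenPartialHomeomorph M (Model d)) (u : Model d) : Matrix (Fin d) (Fin d) ℝ :=
  Matrix.of fun α β => inner ℝ (coordVec e (e.symm u) α) (coordVec e (e.symm u) β)

/-- The components `g^{αβ}` of the inverse metric. -/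
def gUp (e : OpenPartialHomeomorph M (Model d)) (u : Model d) : Matrix (Fin d) (Fin d) ℝ :=
  (gLow e u)⁻¹

/-- The Christoffel symbols `Γ^ρ_{αβ} = ½ g^{ρσ} (∂_α g_{σβ} + ∂_β g_{σα} - ∂_σ g_{αβ})`. -/
def christoffel (e : OpenPartialHomeomorph M (Model d)) (u : Model d) (ρ α β : Fin d) : ℝ :=
  (1 / 2) * ∑ σ, gUp e u ρ σ *
    (partialD (fun v => gLow e v σ β) α u + partialD (fun v => gLow e v σ α) β u
      - partialD (fun v => gLow e v α β) σ u)

/-- The Hamiltonian `(g^{αβ}(u) ξ_α ξ_β)^{1/2}` in the coordinates given by `e`. -/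
def hamCoord (e : OpenPartialHomeomorph M (Model d)) (u ξ : Model d) : ℝ :=
  Real.sqrt (∑ α, ∑ β, gUp e u α β * ξ α * ξ β)

/-- The Hamiltonian `h(x, ξ) = (g^{αβ}(x) ξ_α ξ_β)^{1/2}` as a function on `T*M`. The value does
not depend on the coordinates; the preferred chart at `x` is used. -/
def ham (p : CotangentBundle d M) : ℝ :=
  hamCoord (chartAt (Model d) p.proj) (chartAt (Model d) p.proj p.proj)
    (WithLp.toLp 2 (momCoord (chartAt (Model d) p.proj) p))

/-- `c(t) = (x(t), ξ(t))` is a trajectory of Hamilton's equations `ẋ^α = ∂h/∂ξ_α`,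
`ξ̇_α = -∂h/∂x^α`: it is continuous, and the equations hold in all local coordinates. -/
def IsHamiltonTrajectory [IsManifold 𝓘(ℝ, Model d) ∞ M] (c : ℝ → CotangentBundle d M) : Prop :=
  Continuous c ∧
  ∀ e ∈ IsManifold.maximalAtlas 𝓘(ℝ, Model d) ∞ M, ∀ t : ℝ, (c t).proj ∈ e.source →
    ∀ α : Fin d,
      HasDerivAt (fun τ => e (c τ).proj α)
        (partialD (fun ξ => hamCoord e (e (c t).proj) ξ) α (WithLp.toLp 2 (momCoord e (c t)))) t ∧
      HasDerivAt (fun τ => momCoord e (c τ) α)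
        (-partialD (fun u => hamCoord e u (WithLp.toLp 2 (momCoord e (c t)))) α (e (c t).proj)) t

/-- `Φ t (y, η) = (x*(t; y, η), ξ*(t; y, η))` is the (co)geodesic flow on `T'M = T*M \ 0`: the
global solution of Hamilton's equations with `Φ 0 (y, η) = (y, η)`. Values of `Φ` on the zero
section are irrelevant. -/
def IsCogeodesicFlow [IsManifold 𝓘(ℝ, Model d) ∞ M]
    (Φ : ℝ → CotangentBundle d M → CotangentBundle d M) : Prop :=
  ∀ p : CotangentBundle d M, p.2 ≠ 0 → IsHamiltonTrajectory (fun t => Φ t p) ∧ Φ 0 p = p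

/-- `γ` is a geodesic: a smooth curve with `γ̈^ρ + Γ^ρ_{αβ}(γ) γ̇^α γ̇^β = 0` in all local
coordinates. Since geodesics on a closed manifold extend to the whole line, `γ` is defined
on `ℝ`. -/
def IsGeodesic (d : ℕ) {M : Type*} [MetricSpace M] [ChartedSpace (Model d) M]
    [RiemannianBundle (fun x : M => TangentSpace 𝓘(ℝ, Model d) x)]
    [IsManifold 𝓘(ℝ, Model d) ∞ M] (γ : ℝ → M) : Prop :=
  ContMDiff 𝓘(ℝ, ℝ) 𝓘(ℝ, Model d) ∞ γ ∧
  ∀ e ∈ IsManifold.maximalAtlas 𝓘(ℝ, Model d) ∞ M, ∀ s : ℝ, γ s ∈ e.source → ∀ ρ : Fin d,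
    deriv (deriv (fun τ => e (γ τ) ρ)) s
      + ∑ α, ∑ β, christoffel e (e (γ s)) ρ α β
          * deriv (fun τ => e (γ τ) α) s * deriv (fun τ => e (γ τ) β) s = 0

/-- `γ`, restricted to `[0, 1]`, is a shortest geodesic from `z` to `x`. -/
def IsShortestGeodesic (d : ℕ) {M : Type*} [MetricSpace M] [ChartedSpace (Model d) M]
    [RiemannianBundle (fun x : M => TangentSpace 𝓘(ℝ, Model d) x)]
    [IsManifold 𝓘(ℝ, Model d) ∞ M] (γ : ℝ → M) (z x : M) : Prop :=
  IsGeodesic d γ ∧ γ 0 = z ∧ γ 1 = x ∧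
    Manifold.pathELength 𝓘(ℝ, Model d) γ 0 1 = edist z x

/-- The covector field `c(s) = (γ(s), ζ(s))` along its base curve `γ` is parallel:
`ζ̇_β - Γ^ρ_{αβ}(γ) γ̇^α ζ_ρ = 0` in all local coordinates. -/
def IsParallelCovector [IsManifold 𝓘(ℝ, Model d) ∞ M] (c : ℝ → CotangentBundle d M) : Prop :=
  ∀ e ∈ IsManifold.maximalAtlas 𝓘(ℝ, Model d) ∞ M, ∀ s : ℝ, (c s).proj ∈ e.source →
    ∀ β : Fin d,
      HasDerivAt (fun τ => momCoord e (c τ) β)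
        (∑ α, ∑ ρ, christoffel e (e (c s).proj) ρ α β
          * deriv (fun τ => e (c τ).proj α) s * momCoord e (c s) ρ) s

/-- `φ(t, x; y, η)` is a Levi-Civita phase function with parameter `ε`, for the cogeodesic flow
`Φ`: it is smooth on `ℝ × M × T'M`, has `Im φ ≥ 0`, and for `x` near `x* = x*(t; y, η)` it equals
`∫_γ ζ dz + (i ε / 2) h(y, η) dist²(x, x*)`, where `γ` is the shortest geodesic from `x*` to `x`
and `ζ` is the parallel transport of `ξ*(t; y, η)` along `γ` (with `c = (γ, ζ)` below). -/
structure IsLeviCivitaPhase [IsManifold 𝓘(ℝ, Model d) ∞ M]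
    (Φ : ℝ → CotangentBundle d M → CotangentBundle d M) (ε : ℝ)
    (φ : ℝ → M → CotangentBundle d M → ℂ) : Prop where
  smooth : ContMDiffOn
    (𝓘(ℝ, ℝ).prod (𝓘(ℝ, Model d).prod (𝓘(ℝ, Model d).prod 𝓘(ℝ, Model d →L[ℝ] ℝ)))) 𝓘(ℝ, ℂ) ∞
    (fun r : ℝ × M × CotangentBundle d M => φ r.1 r.2.1 r.2.2) {r | r.2.2.2 ≠ 0}
  im_nonneg : ∀ (t : ℝ) (x : M) (p : CotangentBundle d M), p.2 ≠ 0 → 0 ≤ (φ t x p).im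
  eq_near : ∀ (t : ℝ) (p : CotangentBundle d M), p.2 ≠ 0 → ∀ᶠ x in 𝓝 (Φ t p).proj,
    ∃ c : ℝ → CotangentBundle d M,
      IsShortestGeodesic d (fun s => (c s).proj) (Φ t p).proj x ∧
      c 0 = Φ t p ∧ IsParallelCovector c ∧
      φ t x p =
        ((∫ s in (0 : ℝ)..1, pairing (c s).2 (velocity (fun σ => (c σ).proj) s) : ℝ) : ℂ)
          + Complex.I * ε / 2 * ham p * (dist x (Φ t p).proj : ℂ) ^ 2

end Riemannian

section Derivatives

variable {d : ℕ} {M : Type*} [MetricSpace M] [ChartedSpace (Model d) M]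

/-- The component `[x*(t; y, η)]^α` in the coordinates `e`, as a function of `η ∈ T*_y M`. -/
def xStar (e : OpenPartialHomeomorph M (Model d))
    (Φ : ℝ → CotangentBundle d M → CotangentBundle d M) (t : ℝ) (y : M) (α : Fin d)
    (η : Cotangent d y) : ℝ :=
  e (Φ t ⟨y, η⟩).proj α

/-- The component `ξ*_α(t; y, η)` in the coordinates `e`, as a function of `η ∈ T*_y M`. -/
def xiStar (e : OpenPartialHomeomorph M (Model d))
    (Φ : ℝ → CotangentBundle d M → CotangentBundle d M) (t : ℝ) (y : M) (α : Fin d)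
    (η : Cotangent d y) : ℝ :=
  momCoord e (Φ t ⟨y, η⟩) α

/-- `∂F/∂η_μ` for a function of `η ∈ T*_y M`, where `η = η_μ dy^μ` in the coordinates `y` given by
the chart `e'`. -/
def etaD (e' : OpenPartialHomeomorph M (Model d)) {F : Type*} [NormedAddCommGroup F]
    [NormedSpace ℝ F] {y : M} (f : Cotangent d y → F) (μ : Fin d) (η : Cotangent d y) : F :=
  lineDeriv ℝ f η (coordCovec e' y μ)

/-- `∂f/∂η_μ` exists at `η`. -/
def EtaDifferentiableAt (e' : OpenPartialHomeomorph M (Model d)) {F : Type*}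
    [NormedAddCommGroup F] [NormedSpace ℝ F] {y : M} (f : Cotangent d y → F) (μ : Fin d)
    (η : Cotangent d y) : Prop :=
  LineDifferentiableAt ℝ f η (coordCovec e' y μ)

/-- `q^{αμ}(η; t, y) = ∂[x*(η)]^α / ∂η_μ`. -/
def q (e e' : OpenPartialHomeomorph M (Model d))
    (Φ : ℝ → CotangentBundle d M → CotangentBundle d M) (t : ℝ) (y : M) (η : Cotangent d y)
    (α μ : Fin d) : ℝ :=
  etaD e' (xStar e Φ t y α) μ η

/-- `p^{αμ}(η; t, y) = g^{αγ}(x*) [∂ξ*_γ/∂η_μ - Γ^ρ_{γβ}(x*) ξ*_ρ ∂(x*)^β/∂η_μ]`. -/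
def p [RiemannianBundle (fun x : M => TangentSpace 𝓘(ℝ, Model d) x)]
    (e e' : OpenPartialHomeomorph M (Model d))
    (Φ : ℝ → CotangentBundle d M → CotangentBundle d M) (t : ℝ) (y : M) (η : Cotangent d y)
    (α μ : Fin d) : ℝ :=
  ∑ γ, gUp e (e (Φ t ⟨y, η⟩).proj) α γ *
    (etaD e' (xiStar e Φ t y γ) μ η
      - ∑ ρ, ∑ β, christoffel e (e (Φ t ⟨y, η⟩).proj) ρ γ β
          * xiStar e Φ t y ρ η * etaD e' (xStar e Φ t y β) μ η)

/-- `φ_{x^α}(t, x; y, η)` at the point `x` with coordinates `u` in the chart `e`. -/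
def phiX (e : OpenPartialHomeomorph M (Model d)) (φ : ℝ → M → CotangentBundle d M → ℂ)
    (t : ℝ) (y : M) (α : Fin d) (u : Model d) (η : Cotangent d y) : ℂ :=
  partialD (fun v => φ t (e.symm v) ⟨y, η⟩) α u

end Derivatives

end LeviCivitaPhase

end

/-! Fix `t` and write `x*`, `ξ*` as functions of `η`. The formula comes from differentiating the
identity `φ_x(x*(η); η) = ξ*(η)` in `η`: it gives `φ_{xη} = ξ*_η - φ_{xx} x*_η`, and the Hessian at
`x*` is `φ_{xx}(a, b) = ξ*(Γ(a, b)) + iεh g(a, b)`. Lowering the index of `p` then yields the claim.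

Gradient and Hessian (`fderiv_phase_eq`) are read off a second order expansion. Along a geodesic
with initial velocity `v`, the pairing of a parallel covector with the velocity is constant, so the
integral is `ξ*(v)`. The speed is constant too, so `g(v, v) = dist²`. The geodesic equation gives `x
- x* = v - Γ(v, v)/2 + o(dist²)` in any chart (`exists_shortestGeodesic_expansion`). Solving for `v`
gives a quadratic polynomial in `x - x*` up to `o(|x - x*|²)` (`isLittleO_of_forall_expansion`); as
`φ` is smooth, it is the Taylor polynomial (`fderiv_eq_of_isLittleO`).

Differentiability of the flow in `η` is not assumed; it is extracted from the phase. Since `φ_x =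
ξ*` is real, `x*` is a critical point of `Im φ`, nondegenerate because `Im φ_{xx} = εh g` is
positive definite. The implicit function theorem therefore describes nearby critical points by a
`C¹` function of time and momentum. To know that `x*` is the critical point so described, continuity
of `x*` in `η` is needed: it holds at time 0, where `x* = y`, and spreads to all times along the
continuous trajectories by connectedness (`exists_continuousAt_propagation`,
`continuousAt_flow_proj`). Then `ξ* = φ_x` at `x*` is differentiable as well. -/

namespace LeviCivitaPhase

set_option linter.unusedSectionVars false

/-! ### Bilinear expressions in coordinates -/

section Coefficients

variable {d : ℕ}

/-- The bilinear form with the given matrix. -/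
def bilinearForm (g : Matrix (Fin d) (Fin d) ℝ) (a b : Model d) : ℝ :=
  ∑ α, ∑ β, g α β * a α * b β

/-- The vector-valued bilinear map with the given coefficients. -/
noncomputable def bilinearMap (c : Fin d → Fin d → Fin d → ℝ) (a b : Model d) : Model d :=
  ∑ ρ, ∑ α, ∑ β, (c ρ α β * a α * b β) • EuclideanSpace.single ρ (1 : ℝ)

theorem bilinearMap_apply (c : Fin d → Fin d → Fin d → ℝ) (a b : Model d) (ρ : Fin d) :
    bilinearMap c a b ρ = ∑ α, ∑ β, c ρ α β * a α * b β := by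
  simp only [bilinearMap, WithLp.ofLp_sum, Finset.sum_apply, PiLp.smul_apply, smul_eq_mul]
  rw [Finset.sum_eq_single ρ]
  · simp
  · intro b _ hb
    simp [hb.symm]
  · simp

theorem partialD_eq_fderiv {F : Type*} [NormedAddCommGroup F] [NormedSpace ℝ F]
    {f : Model d → F} {u : Model d} (hf : DifferentiableAt ℝ f u) (α : Fin d) :
    partialD f α u = fderiv ℝ f u (EuclideanSpace.single α 1) :=
  hf.lineDeriv_eq_fderiv

theorem eq_sum_smul_single (a : Model d) : a = ∑ σ, a σ • EuclideanSpace.single σ (1 : ℝ) := by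
  ext i
  simp [Finset.sum_apply, Pi.single_apply]

theorem fderiv_eq_sum_partialD {f : Model d → ℝ} {u : Model d} (hf : DifferentiableAt ℝ f u)
    (a : Model d) : fderiv ℝ f u a = ∑ σ, partialD f σ u * a σ := by
  conv_lhs => rw [eq_sum_smul_single a]
  rw [map_sum]
  refine Finset.sum_congr rfl fun σ _ => ?_
  rw [map_smul, partialD_eq_fderiv hf, smul_eq_mul, mul_comm]

theorem hasDerivAt_coord {k : ℝ → Model d} {k' : Model d} {s : ℝ} (h : HasDerivAt k k' s)
    (α : Fin d) : HasDerivAt (fun τ => k τ α) (k' α) s :=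
  (EuclideanSpace.proj α : Model d →L[ℝ] ℝ).hasFDerivAt.comp_hasDerivAt s h

theorem hasDerivAt_bilinearForm {g : Model d → Matrix (Fin d) (Fin d) ℝ}
    (hsymm : ∀ u α β, g u α β = g u β α) {k v : ℝ → Model d} {a : Model d} {s : ℝ}
    (hg : ∀ α β, DifferentiableAt ℝ (fun u => g u α β) (k s)) (hk : HasDerivAt k (v s) s)
    (hv : HasDerivAt v a s) :
    HasDerivAt (fun τ => bilinearForm (g (k τ)) (v τ) (v τ))
      (∑ α, ∑ β, ∑ σ, partialD (fun u => g u α β) σ (k s) * v s σ * v s α * v s β +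
        2 * bilinearForm (g (k s)) (v s) a) s := by
  unfold bilinearForm
  have h := HasDerivAt.fun_sum (u := Finset.univ) fun α _ =>
    HasDerivAt.fun_sum (u := Finset.univ) fun β _ =>
      (((hg α β).hasFDerivAt.comp_hasDerivAt s hk).mul (hasDerivAt_coord hv α)).mul
        (hasDerivAt_coord hv β)
  refine h.congr_deriv ?_
  simp only [fderiv_eq_sum_partialD (hg _ _)]
  have h2 : ∑ α, ∑ β, g (k s) α β * a α * v s β = ∑ α, ∑ β, g (k s) α β * v s α * a β := by
    rw [Finset.sum_comm]
    refine Finset.sum_congr rfl fun α _ => Finset.sum_congr rfl fun β _ => ?_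
    rw [hsymm]
    ring
  rw [two_mul]
  nth_rewrite 1 [← h2]
  simp_rw [← Finset.sum_add_distrib]
  refine Finset.sum_congr rfl fun α _ => Finset.sum_congr rfl fun β _ => ?_
  simp only [Function.comp, Pi.mul_apply, ← Finset.sum_mul]
  ring

end Coefficients

/-! ### Vectors and covectors in a chart -/

section ChartCalculus

variable {d : ℕ} {M : Type*} [TopologicalSpace M] [ChartedSpace (Model d) M]
  [IsManifold 𝓘(ℝ, Model d) ∞ M] {e : OpenPartialHomeomorph M (Model d)}

/-- The components of a tangent vector in the chart `e`. -/
noncomputable def vecCoord (e : OpenPartialHomeomorph M (Model d)) {x : M}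
    (v : TangentSpace 𝓘(ℝ, Model d) x) : Model d :=
  mfderiv 𝓘(ℝ, Model d) 𝓘(ℝ, Model d) e x v

/-- The components of a covector as a linear form on the coordinate space. -/
noncomputable def momForm (e : OpenPartialHomeomorph M (Model d)) (p : CotangentBundle d M) :
    Model d →L[ℝ] ℝ :=
  ∑ α, momCoord e p α • (EuclideanSpace.proj α : Model d →L[ℝ] ℝ)

theorem momForm_apply (p : CotangentBundle d M) (a : Model d) :
    momForm e p a = ∑ α, momCoord e p α * a α := by
  simp [momForm]

theorem momForm_single (p : CotangentBundle d M) (α : Fin d) :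
    momForm e p (EuclideanSpace.single α 1) = momCoord e p α := by
  simp [momForm_apply]

theorem mdifferentiable_of_mem_maximalAtlas
    (he : e ∈ IsManifold.maximalAtlas 𝓘(ℝ, Model d) ∞ M) :
    e.MDifferentiable 𝓘(ℝ, Model d) 𝓘(ℝ, Model d) :=
  ⟨(contMDiffOn_of_mem_maximalAtlas he).mdifferentiableOn (by simp),
    (contMDiffOn_symm_of_mem_maximalAtlas he).mdifferentiableOn (by simp)⟩

theorem eq_sum_coordVec (he : e ∈ IsManifold.maximalAtlas 𝓘(ℝ, Model d) ∞ M) {x : M}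
    (hx : x ∈ e.source) (v : TangentSpace 𝓘(ℝ, Model d) x) :
    v = ∑ α, vecCoord e v α • coordVec e x α := by
  have hinv : (mfderiv 𝓘(ℝ, Model d) 𝓘(ℝ, Model d) e x).IsInvertible :=
    ⟨(mdifferentiable_of_mem_maximalAtlas he).mfderiv hx, rfl⟩
  apply hinv.injective
  rw [map_sum]
  have : ∀ α, mfderiv 𝓘(ℝ, Model d) 𝓘(ℝ, Model d) e x (vecCoord e v α • coordVec e x α)
      = (vecCoord e v α • EuclideanSpace.single α (1 : ℝ) : Model d) := by
    intro α
    rw [map_smul]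
    congr 1
    exact hinv.self_apply_inverse _
  rw [Finset.sum_congr rfl fun α _ => this α]
  change vecCoord e v = ∑ α, (vecCoord e v α • EuclideanSpace.single α (1 : ℝ) : Model d)
  ext i
  simp [Finset.sum_apply, Pi.single_apply]

/-- Turns the invariant pairing into a fixed linear form on `ℝ^d`, so that calculus can be done in
the chart. -/
theorem pairing_eq_momForm (he : e ∈ IsManifold.maximalAtlas 𝓘(ℝ, Model d) ∞ M)
    (p : CotangentBundle d M) (hx : p.proj ∈ e.source) (v : TangentSpace 𝓘(ℝ, Model d) p.proj) :
    pairing p.2 v = momForm e p (vecCoord e v) := by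
  rw [momForm_apply]
  conv_lhs => rw [eq_sum_coordVec he hx v]
  simp [pairing, momCoord, mul_comm]

theorem hasDerivAt_chart_comp (he : e ∈ IsManifold.maximalAtlas 𝓘(ℝ, Model d) ∞ M)
    {γ : ℝ → M} {s : ℝ} (hγ : MDifferentiableAt 𝓘(ℝ, ℝ) 𝓘(ℝ, Model d) γ s)
    (hs : γ s ∈ e.source) :
    HasDerivAt (fun τ => e (γ τ)) (vecCoord e (velocity γ s)) s := by
  have h1 := ((mdifferentiable_of_mem_maximalAtlas he).mdifferentiableAt hs).hasMFDerivAt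
  obtain ⟨L, hL, hv⟩ : ∃ L : ℝ →L[ℝ] Model d,
      HasFDerivAt (fun τ => e (γ τ)) L s ∧ L 1 = vecCoord e (velocity γ s) :=
    ⟨_, (h1.comp s hγ.hasMFDerivAt).hasFDerivAt, rfl⟩
  exact hv ▸ hL.hasDerivAt

end ChartCalculus

/-! ### The metric and the Christoffel symbols in a chart -/

section Riemannian

variable {d : ℕ} {M : Type*} [MetricSpace M] [ChartedSpace (Model d) M]
  [IsManifold 𝓘(ℝ, Model d) ∞ M]
  [RiemannianBundle (fun x : M => TangentSpace 𝓘(ℝ, Model d) x)]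
  {e : OpenPartialHomeomorph M (Model d)}

/-- The metric in the chart `e` as a bilinear form on the coordinate space. -/
noncomputable def metricForm (e : OpenPartialHomeomorph M (Model d)) (u a b : Model d) : ℝ :=
  bilinearForm (gLow e u) a b

/-- The Christoffel symbols in the chart `e` as a bilinear map on the coordinate space. -/
noncomputable def christoffelForm (e : OpenPartialHomeomorph M (Model d)) (u a b : Model d) : Model d :=
  bilinearMap (christoffel e u) a b

theorem metricForm_apply (u a b : Model d) :
    metricForm e u a b = ∑ α, ∑ β, gLow e u α β * a α * b β :=
  rfl

theorem christoffelForm_apply (u a b : Model d) (ρ : Fin d) :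
    christoffelForm e u a b ρ = ∑ α, ∑ β, christoffel e u ρ α β * a α * b β :=
  bilinearMap_apply _ a b ρ

theorem gLow_comm (u : Model d) (α β : Fin d) : gLow e u α β = gLow e u β α := by
  simp [gLow, real_inner_comm]

theorem metricForm_comm (u a b : Model d) : metricForm e u a b = metricForm e u b a := by
  rw [metricForm_apply, metricForm_apply, Finset.sum_comm]
  simp_rw [gLow_comm u, mul_right_comm]

theorem christoffel_comm (u : Model d) (ρ α β : Fin d) :
    christoffel e u ρ α β = christoffel e u ρ β α := by
  unfold christoffel
  congr 1
  refine Finset.sum_congr rfl fun σ _ => ?_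
  simp_rw [gLow_comm (e := e) _ α β]
  ring

theorem christoffelForm_comm (u a b : Model d) :
    christoffelForm e u a b = christoffelForm e u b a := by
  ext ρ
  rw [christoffelForm_apply, christoffelForm_apply, Finset.sum_comm]
  simp_rw [christoffel_comm u ρ, mul_right_comm]

theorem inner_eq_metricForm (he : e ∈ IsManifold.maximalAtlas 𝓘(ℝ, Model d) ∞ M) {x : M}
    (hx : x ∈ e.source) (v w : TangentSpace 𝓘(ℝ, Model d) x) :
    inner ℝ v w = metricForm e (e x) (vecCoord e v) (vecCoord e w) := by
  rw [metricForm_apply]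
  conv_lhs => rw [eq_sum_coordVec he hx v, eq_sum_coordVec he hx w]
  simp only [sum_inner, inner_sum, real_inner_smul_left, real_inner_smul_right]
  rw [Finset.sum_comm]
  refine Finset.sum_congr rfl fun α _ => Finset.sum_congr rfl fun β _ => ?_
  rw [gLow, Matrix.of_apply, e.left_inv hx]
  ring

theorem metricForm_pos (he : e ∈ IsManifold.maximalAtlas 𝓘(ℝ, Model d) ∞ M) {u : Model d}
    (hu : u ∈ e.target) {a : Model d} (ha : a ≠ 0) : 0 < metricForm e u a a := by
  have hx := e.map_target hu
  have hd := mdifferentiable_of_mem_maximalAtlas he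
  obtain ⟨v, hv⟩ := hd.mfderiv_surjective hx a
  have := inner_eq_metricForm he hx v v
  rw [e.right_inv hu, show vecCoord e v = a from hv] at this
  rw [← this, real_inner_self_eq_norm_sq]
  have : v ≠ 0 := by
    rintro rfl
    exact ha (hv.symm.trans (map_zero _))
  positivity

theorem gLow_posDef (he : e ∈ IsManifold.maximalAtlas 𝓘(ℝ, Model d) ∞ M) {u : Model d}
    (hu : u ∈ e.target) : (gLow e u).PosDef := by
  refine Matrix.PosDef.of_dotProduct_mulVec_pos (by ext α β; simp [gLow_comm u α β]) ?_
  intro a ha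
  have := metricForm_pos he hu (a := WithLp.toLp 2 a) (by simpa using ha)
  rw [metricForm_apply] at this
  simp only [dotProduct, mulVec, star_trivial, Finset.mul_sum]
  refine this.trans_eq (Finset.sum_congr rfl fun α _ => Finset.sum_congr rfl fun β _ => ?_)
  ring

/-- A covector with zero components vanishes, and the inverse of a positive definite matrix is
positive definite. This positivity makes the Hessian of `Im φ` nondegenerate. -/
theorem ham_pos {p : CotangentBundle d M} (hp : p.2 ≠ 0) : 0 < ham p := by
  set e := chartAt (Model d) p.proj
  have he : e ∈ IsManifold.maximalAtlas 𝓘(ℝ, Model d) ∞ M :=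
    IsManifold.chart_mem_maximalAtlas p.proj
  have hx : p.proj ∈ e.source := mem_chart_source _ _
  have hpd := (gLow_posDef he (e.map_source hx)).inv
  have hm : momCoord e p ≠ 0 := by
    intro h0
    apply hp
    ext v
    have := pairing_eq_momForm he p hx v
    rw [momForm_apply, h0] at this
    refine this.trans ?_
    simp
  have := hpd.dotProduct_mulVec_pos hm
  refine Real.sqrt_pos.2 ?_
  simp only [dotProduct, mulVec, star_trivial, Finset.mul_sum] at this
  refine this.trans_eq (Finset.sum_congr rfl fun α _ => Finset.sum_congr rfl fun β _ => ?_)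
  simp only [gUp]
  ring

end Riemannian

/-! ### Smoothness of the metric coefficients -/

section Smoothness

variable {d : ℕ} {M : Type*} [MetricSpace M] [ChartedSpace (Model d) M]
  [IsManifold 𝓘(ℝ, Model d) ∞ M]
  [RiemannianBundle (fun x : M => TangentSpace 𝓘(ℝ, Model d) x)]
  [IsContMDiffRiemannianBundle 𝓘(ℝ, Model d) ∞ (Model d)
      (fun x : M => TangentSpace 𝓘(ℝ, Model d) x)]
  {e : OpenPartialHomeomorph M (Model d)}

/-- The coordinate fields are the images of constant fields under the tangent map of `e.symm`,
because the differential of `e.symm` inverts that of `e`. -/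
theorem contMDiffOn_coordVec (he : e ∈ IsManifold.maximalAtlas 𝓘(ℝ, Model d) ∞ M) (α : Fin d) :
    ContMDiffOn 𝓘(ℝ, Model d) (𝓘(ℝ, Model d).prod 𝓘(ℝ, Model d)) ∞
      (fun u : Model d => (⟨e.symm u, coordVec e (e.symm u) α⟩ :
        TotalSpace (Model d) (fun x : M => TangentSpace 𝓘(ℝ, Model d) x))) e.target := by
  have h := (contMDiffOn_symm_of_mem_maximalAtlas he).contMDiffOn_tangentMapWithin (m := ∞)
    (by simp) e.open_target.uniqueMDiffOn
  have h2 : ContMDiff 𝓘(ℝ, Model d) (𝓘(ℝ, Model d).prod 𝓘(ℝ, Model d)) ∞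
      (fun u : Model d => (⟨u, (EuclideanSpace.single α (1 : ℝ) : Model d)⟩ :
        TangentBundle 𝓘(ℝ, Model d) (Model d))) :=
    contMDiff_vectorSpace_iff_contDiff.2 contDiff_const
  refine (h.comp h2.contMDiffOn (s := e.target) (fun u hu => hu)).congr fun u hu => ?_
  have hx := e.map_target hu
  have hd := mdifferentiable_of_mem_maximalAtlas he
  simp only [Function.comp, tangentMapWithin]
  rw [mfderivWithin_of_isOpen e.open_target hu]
  congr 1
  have hinv : (mfderiv 𝓘(ℝ, Model d) 𝓘(ℝ, Model d) e (e.symm u)).IsInvertible :=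
    ⟨hd.mfderiv hx, rfl⟩
  apply hinv.injective
  refine (hinv.self_apply_inverse _).trans ?_
  have := hd.symm.symm_comp_deriv (x := u) hu
  exact (congrArg (fun L => L (EuclideanSpace.single α (1 : ℝ) : Model d)) this).symm

theorem contDiffOn_gLow (he : e ∈ IsManifold.maximalAtlas 𝓘(ℝ, Model d) ∞ M) (α β : Fin d) :
    ContDiffOn ℝ ∞ (fun u => gLow e u α β) e.target := by
  rw [← contMDiffOn_iff_contDiffOn]
  exact (contMDiffOn_coordVec he α).inner_bundle (contMDiffOn_coordVec he β)

end Smoothness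

/-! ### Uniqueness of the second order Taylor polynomial -/

section Taylor

open Asymptotics

theorem coeff_eq_zero_of_isLittleO {F : Type*} [NormedAddCommGroup F] [NormedSpace ℝ F]
    {p₀ p₁ p₂ : F}
    (h : (fun r : ℝ => p₀ + r • p₁ + r ^ 2 • p₂) =o[𝓝 0] fun r : ℝ => r ^ 2) :
    p₀ = 0 ∧ p₁ = 0 ∧ p₂ = 0 := by
  have h0 : p₀ = 0 := by
    have h1 : Tendsto (fun r : ℝ => p₀ + r • p₁ + r ^ 2 • p₂) (𝓝 0) (𝓝 p₀) := by
      have : Continuous fun r : ℝ => p₀ + r • p₁ + r ^ 2 • p₂ := by fun_prop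
      simpa using this.tendsto 0
    refine tendsto_nhds_unique h1 (h.trans_tendsto ?_)
    have : Continuous fun r : ℝ => r ^ 2 := by fun_prop
    simpa using this.tendsto 0
  subst h0
  have h1 : p₁ = 0 := by
    have hd : HasDerivAt (fun r : ℝ => (0 : F) + r • p₁ + r ^ 2 • p₂) p₁ 0 := by
      have := ((hasDerivAt_const (0 : ℝ) (0 : F)).add ((hasDerivAt_id (0 : ℝ)).smul_const p₁)).add
        (((hasDerivAt_id (0 : ℝ)).pow 2).smul_const p₂)
      refine this.congr_deriv (by simp)
    refine hd.unique ?_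
    rw [hasDerivAt_iff_isLittleO]
    simpa using h.trans (isLittleO_pow_id one_lt_two)
  subst h1
  refine ⟨rfl, rfl, ?_⟩
  by_contra hp
  have hpos := norm_pos_iff.2 hp
  -- The bound is used at a point of the punctured neighbourhood, since `r = 0` gives no
  -- contradiction.
  have h2 := (h.def (half_pos hpos)).filter_mono (nhdsWithin_le_nhds (s := {0}ᶜ))
  obtain ⟨r, hr, hr0⟩ := (h2.and self_mem_nhdsWithin).exists
  have : 0 < r ^ 2 := by
    have : r ≠ 0 := hr0
    positivity
  simp only [smul_zero, add_zero, zero_add, norm_smul, norm_pow, Real.norm_eq_abs, sq_abs] at hr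
  nlinarith

variable {E : Type*} [NormedAddCommGroup E] [NormedSpace ℝ E]
  {F : Type*} [NormedAddCommGroup F] [NormedSpace ℝ F]

theorem fderiv_fderiv_apply {f : E → F} {u : E} (hf : ContDiffAt ℝ 2 f u) (a b : E) :
    fderiv ℝ (fun w => fderiv ℝ f w a) u b = fderiv ℝ (fderiv ℝ f) u b a := by
  have : DifferentiableAt ℝ (fderiv ℝ f) u :=
    (hf.fderiv_right (m := 1) (by norm_num)).differentiableAt (by simp)
  rw [fderiv_clm_apply this (differentiableAt_const a)]
  simp

/-- The second order Taylor polynomial is unique. -/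
theorem fderiv_eq_of_isLittleO {f : E → F} {u : E} (hf : ContDiffAt ℝ 2 f u) {ℓ : E →L[ℝ] F}
    {Q : E → F} (hQ : ∀ (r : ℝ) a, Q (r • a) = r ^ 2 • Q a)
    (h : (fun w => f w - ℓ (w - u) - Q (w - u)) =o[𝓝 u] fun w => ‖w - u‖ ^ 2) (a b : E) :
    fderiv ℝ f u a = ℓ a ∧
      fderiv ℝ (fun w => fderiv ℝ f w a) u b = Q (a + b) - Q a - Q b := by
  have hd1 : DifferentiableAt ℝ (fderiv ℝ f) u :=
    (hf.fderiv_right (m := 1) (by norm_num)).differentiableAt (by simp)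
  have key : ∀ a, fderiv ℝ f u a = ℓ a ∧ fderiv ℝ (fderiv ℝ f) u a a = (2 : ℝ) • Q a := by
    intro a
    have hline : Continuous fun r : ℝ => u + r • a := by fun_prop
    have hl0 : Tendsto (fun r : ℝ => u + r • a) (𝓝 0) (𝓝 u) := by simpa using hline.tendsto 0
    have hlined : ∀ r : ℝ, HasDerivAt (fun r : ℝ => u + r • a) a r := fun r => by
      simpa using ((hasDerivAt_id r).smul_const a).const_add u
    have hev : ∀ᶠ r : ℝ in 𝓝 0, DifferentiableAt ℝ f (u + r • a) := by
      refine hl0.eventually ?_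
      filter_upwards [hf.eventually (by simp)] with w hw using hw.differentiableAt (by simp)
    obtain ⟨δ, hδ, hball⟩ := Metric.eventually_nhds_iff_ball.1 hev
    set c := fderiv ℝ (fderiv ℝ f) u a a
    -- The restriction of `f` to the line through `u`, without its first and second order terms.
    set χ : ℝ → F := fun r => f (u + r • a) - r • fderiv ℝ f u a - r ^ 2 • ((1 / 2 : ℝ) • c)
    have hχ : ∀ r ∈ Metric.ball (0 : ℝ) δ, HasDerivAt χ
        (fderiv ℝ f (u + r • a) a - fderiv ℝ f u a - r • c) r := by
      intro r hr
      have h1 := (hball r hr).hasFDerivAt.comp_hasDerivAt r (hlined r)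
      have h2 := (h1.sub ((hasDerivAt_id r).smul_const (fderiv ℝ f u a))).sub
        (((hasDerivAt_id r).pow 2).smul_const ((1 / 2 : ℝ) • c))
      refine h2.congr_deriv ?_
      simp only [one_smul, id, smul_smul]
      congr 2
      norm_num
      ring
    have hψ : HasDerivAt (fun r : ℝ => fderiv ℝ f (u + r • a) a) c 0 := by
      have h1 : HasFDerivAt (fderiv ℝ f) (fderiv ℝ (fderiv ℝ f) u) (u + (0 : ℝ) • a) := by
        simpa using hd1.hasFDerivAt
      have h2 := h1.comp_hasDerivAt (0 : ℝ) (hlined 0)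
      simpa using h2.clm_apply (hasDerivAt_const (0 : ℝ) a)
    have ho : (fun r : ℝ => fderiv ℝ f (u + r • a) a - fderiv ℝ f u a - r • c)
        =o[𝓝[Metric.ball 0 δ] 0] fun r : ℝ => (r - 0) ^ 1 := by
      refine IsLittleO.mono ?_ nhdsWithin_le_nhds
      simpa using hasDerivAt_iff_isLittleO.1 hψ
    -- The derivative of `χ` is `o(r)`, hence `χ r - χ 0` is `o(r²)`.
    have hχo := (convex_ball (0 : ℝ) δ).isLittleO_pow_succ_real (Metric.mem_ball_self hδ)
      (fun r hr => (hχ r hr).hasDerivWithinAt) ho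
    rw [nhdsWithin_eq_nhds.2 (Metric.ball_mem_nhds _ hδ)] at hχo
    have hl : (fun r : ℝ => f (u + r • a) - r • ℓ a - r ^ 2 • Q a) =o[𝓝 0] fun r : ℝ => r ^ 2 := by
      have h1 := h.comp_tendsto hl0
      have h2 : (fun r : ℝ => ‖u + r • a - u‖ ^ 2) =O[𝓝 0] fun r : ℝ => r ^ 2 := by
        refine IsBigO.of_bound (‖a‖ ^ 2) (Eventually.of_forall fun r => ?_)
        simp [norm_smul, mul_pow, mul_comm]
      refine (h1.trans_isBigO h2).congr_left fun r => ?_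
      simp [hQ]
    have hsub := hχo.sub (by simpa using hl)
    -- The two expansions differ by a quadratic polynomial in `r` that is `o(r²)`, so all its
    -- coefficients vanish.
    have hcoef := coeff_eq_zero_of_isLittleO (p₀ := -f u) (p₁ := ℓ a - fderiv ℝ f u a)
      (p₂ := Q a - (1 / 2 : ℝ) • c) (by
        refine (hsub.congr (fun r => ?_) fun r => by simp)
        simp only [χ, smul_sub]
        simp
        abel)
    refine ⟨(sub_eq_zero.1 hcoef.2.1).symm, ?_⟩
    rw [sub_eq_zero.1 hcoef.2.2, smul_smul]
    norm_num
  refine ⟨(key a).1, ?_⟩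
  rw [fderiv_fderiv_apply hf]
  have hsymm : IsSymmSndFDerivAt ℝ f u := hf.isSymmSndFDerivAt (by simp)
  -- Polarisation: the Hessian is symmetric and is already known on the diagonal.
  have h1 := (key (a + b)).2
  simp only [map_add, _root_.add_apply, (key a).2, (key b).2, hsymm.eq a b] at h1
  have h2 : (2 : ℝ) • fderiv ℝ (fderiv ℝ f) u b a = (2 : ℝ) • (Q (a + b) - Q a - Q b) := by
    rw [smul_sub, smul_sub, ← h1, two_smul]
    abel
  exact smul_right_injective F (two_ne_zero (α := ℝ)) h2

end Taylor

/-! ### Estimates for bilinear maps given by coefficients -/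

section Bilinear

variable {ι : Type*} [Fintype ι] {E : Type*} [NormedAddCommGroup E] [NormedSpace ℝ E]
  {F : Type*} [NormedAddCommGroup F] [NormedSpace ℝ F]

theorem norm_sum_bilinear_le (c : ι → ℝ) (l m : ι → E →L[ℝ] ℝ) (w : ι → F) (a b : E) :
    ‖∑ i, (c i * l i a * m i b) • w i‖ ≤
      (∑ i, |c i| * (‖l i‖ * ‖m i‖ * ‖w i‖)) * (‖a‖ * ‖b‖) := by
  refine (norm_sum_le _ _).trans ?_
  rw [Finset.sum_mul]
  refine Finset.sum_le_sum fun i _ => ?_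
  rw [norm_smul, norm_mul, norm_mul, Real.norm_eq_abs]
  calc |c i| * ‖l i a‖ * ‖m i b‖ * ‖w i‖
      ≤ |c i| * (‖l i‖ * ‖a‖) * (‖m i‖ * ‖b‖) * ‖w i‖ := by
        gcongr <;> exact ContinuousLinearMap.le_opNorm _ _
    _ = |c i| * (‖l i‖ * ‖m i‖ * ‖w i‖) * (‖a‖ * ‖b‖) := by ring

/-- Near `u₀`, a bilinear map with coefficients continuous at `u₀` is close to the one at `u₀`. -/
theorem eventually_norm_sum_bilinear_sub_le {X : Type*} [TopologicalSpace X] {u₀ : X}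
    {c : ι → X → ℝ} (hc : ∀ i, ContinuousAt (c i) u₀)
    (l m : ι → E →L[ℝ] ℝ) (w : ι → F) {η : ℝ} (hη : 0 < η) :
    ∀ᶠ u in 𝓝 u₀, ∀ a b, ‖∑ i, (c i u * l i a * m i b) • w i -
      ∑ i, (c i u₀ * l i a * m i b) • w i‖ ≤ η * (‖a‖ * ‖b‖) := by
  have ht : Tendsto (fun u => ∑ i, |c i u - c i u₀| * (‖l i‖ * ‖m i‖ * ‖w i‖)) (𝓝 u₀) (𝓝 0) := by
    have : ContinuousAt (fun u => ∑ i, |c i u - c i u₀| * (‖l i‖ * ‖m i‖ * ‖w i‖)) u₀ :=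
      tendsto_finsetSum _ fun i _ => (((hc i).sub continuousAt_const).abs).mul continuousAt_const
    simpa [ContinuousAt] using this
  filter_upwards [ht.eventually (gt_mem_nhds hη)] with u hu a b
  have := norm_sum_bilinear_le (fun i => c i u - c i u₀) l m w a b
  simp only [sub_mul, sub_smul, Finset.sum_sub_distrib] at this
  refine this.trans ?_
  gcongr

/-- From `B(a, a) - B(b, b) = B(a - b, a) + B(b, a - b)`. It controls the cost of replacing the
initial velocity by the displacement in the quadratic terms. -/
theorem norm_sum_bilinear_diag_sub_le (c : ι → ℝ) (l m : ι → E →L[ℝ] ℝ) (w : ι → F) (a b : E) :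
    ‖∑ i, (c i * l i a * m i a) • w i - ∑ i, (c i * l i b * m i b) • w i‖ ≤
      (∑ i, |c i| * (‖l i‖ * ‖m i‖ * ‖w i‖)) * (‖a - b‖ * (‖a‖ + ‖b‖)) := by
  have h1 := norm_sum_bilinear_le c l m w (a - b) a
  have h2 := norm_sum_bilinear_le c l m w b (a - b)
  have h3 : ∑ i, (c i * l i a * m i a) • w i - ∑ i, (c i * l i b * m i b) • w i =
      ∑ i, (c i * l i (a - b) * m i a) • w i + ∑ i, (c i * l i b * m i (a - b)) • w i := by
    rw [← Finset.sum_sub_distrib, ← Finset.sum_add_distrib]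
    refine Finset.sum_congr rfl fun i _ => ?_
    rw [← sub_smul, ← add_smul, map_sub, map_sub]
    congr 1
    ring
  rw [h3]
  refine (norm_add_le _ _).trans ((add_le_add h1 h2).trans (le_of_eq ?_))
  ring

theorem exists_bound_sum_bilinear (c : ι → ℝ) (l m : ι → E →L[ℝ] ℝ) (w : ι → F) : ∃ K, 0 ≤ K ∧
    (∀ a b, ‖∑ i, (c i * l i a * m i a) • w i - ∑ i, (c i * l i b * m i b) • w i‖ ≤
      K * (‖a - b‖ * (‖a‖ + ‖b‖))) ∧
    ∀ a, ‖∑ i, (c i * l i a * m i a) • w i‖ ≤ K * ‖a‖ ^ 2 :=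
  ⟨∑ i, |c i| * (‖l i‖ * ‖m i‖ * ‖w i‖), by positivity,
    norm_sum_bilinear_diag_sub_le c l m w, fun a => by
      rw [sq]
      exact norm_sum_bilinear_le c l m w a a⟩

/-- A quadratic form that is positive definite at `u₀` is uniformly so near `u₀`. -/
theorem exists_eventually_le_sum_quadratic [FiniteDimensional ℝ E]
    {X : Type*} [TopologicalSpace X] {u₀ : X}
    {c : ι → X → ℝ} (hc : ∀ i, ContinuousAt (c i) u₀) (l m : ι → E →L[ℝ] ℝ)
    (hpos : ∀ a, a ≠ 0 → 0 < ∑ i, c i u₀ * l i a * m i a) :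
    ∃ κ > 0, ∀ᶠ u in 𝓝 u₀, ∀ a, κ * ‖a‖ ^ 2 ≤ ∑ i, c i u * l i a * m i a := by
  have hcont : Continuous fun a => ∑ i, c i u₀ * l i a * m i a := by fun_prop
  obtain ⟨κ, hκ, hle⟩ : ∃ κ > 0, ∀ a, κ * ‖a‖ ^ 2 ≤ ∑ i, c i u₀ * l i a * m i a := by
    obtain ⟨κ, hκ, hle⟩ := (isCompact_sphere (0 : E) 1).exists_forall_le'
      hcont.continuousOn (a := 0) fun a ha => hpos a (by rintro rfl; simp at ha)
    refine ⟨κ, hκ, fun a => ?_⟩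
    rcases eq_or_ne a 0 with rfl | ha
    · simp
    · have hn := norm_pos_iff.2 ha
      have h1 := hle (‖a‖⁻¹ • a) (by simp [norm_smul, hn.ne'])
      have h2 : ∑ i, c i u₀ * l i (‖a‖⁻¹ • a) * m i (‖a‖⁻¹ • a) =
          (‖a‖ ^ 2)⁻¹ * ∑ i, c i u₀ * l i a * m i a := by
        rw [Finset.mul_sum]
        refine Finset.sum_congr rfl fun i _ => ?_
        simp only [map_smul, smul_eq_mul]
        field_simp
      rw [h2] at h1
      rwa [← le_inv_mul_iff₀' (by positivity)]
  refine ⟨κ / 2, half_pos hκ, ?_⟩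
  filter_upwards [eventually_norm_sum_bilinear_sub_le hc l m (fun _ => (1 : ℝ)) (half_pos hκ)]
    with u hu a
  have h1 := hu a a
  simp only [smul_eq_mul, mul_one] at h1
  have h2 := (abs_le.1 h1).1
  have h3 := hle a
  nlinarith

end Bilinear

/-! ### Expansion of solutions of the geodesic equation -/

section SecondOrderODE

variable {E : Type*} [NormedAddCommGroup E] [NormedSpace ℝ E]

/-- Second order expansion of the solutions of `k'' = -Γ(k)(k', k')`, in terms of the speed. -/
theorem exists_forall_geodesic_expansion {Γ : E → E → E → E} {u₀ : E} {K : ℝ} (hK : 0 ≤ K)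
    (h₁ : ∀ a b, ‖Γ u₀ a a - Γ u₀ b b‖ ≤ K * (‖a - b‖ * (‖a‖ + ‖b‖)))
    (h₂ : ∀ η > 0, ∀ᶠ u in 𝓝 u₀, ∀ a, ‖Γ u a a - Γ u₀ a a‖ ≤ η * ‖a‖ ^ 2)
    (h₃ : ∀ a, ‖Γ u₀ a a‖ ≤ K * ‖a‖ ^ 2) {η : ℝ} (hη : 0 < η) :
    ∃ ρ > 0, ∀ D < ρ, ∀ k v : ℝ → E, k 0 = u₀ →
      (∀ s ∈ Set.Icc (0 : ℝ) 1, HasDerivAt k (v s) s ∧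
        HasDerivAt v (-Γ (k s) (v s) (v s)) s ∧ ‖v s‖ ≤ D) →
      ‖k 1 - u₀ - v 0 + (1 / 2 : ℝ) • Γ u₀ (v 0) (v 0)‖ ≤ η * D ^ 2 := by
  obtain ⟨ρ₁, hρ₁, hb₁⟩ := Metric.eventually_nhds_iff_ball.1 (h₂ (η / 2) (half_pos hη))
  obtain ⟨ρ₂, hρ₂, hb₂⟩ := Metric.eventually_nhds_iff_ball.1 (h₂ 1 one_pos)
  -- Chosen so that `2 (K + 1)² ρ₃ = η / 2`: the change of velocity then costs at most `η / 2 * D ^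
  -- 2`, the other half being spent on the change of base point.
  set ρ₃ := η / (4 * (K + 1) * (K + 1))
  have hρ₃ : 0 < ρ₃ := by positivity
  refine ⟨min ρ₁ (min ρ₂ ρ₃), by positivity, fun D hD k v hk0 hkv => ?_⟩
  have hD0 : 0 ≤ D := (norm_nonneg _).trans (hkv 0 (by simp)).2.2
  have hD₁ : D < ρ₁ := hD.trans_le (min_le_left _ _)
  have hD₂ : D < ρ₂ := hD.trans_le ((min_le_right _ _).trans (min_le_left _ _))
  have hD₃ : D < ρ₃ := hD.trans_le ((min_le_right _ _).trans (min_le_right _ _))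
  have hks : ∀ s ∈ Set.Icc (0 : ℝ) 1, ‖k s - u₀‖ ≤ D := by
    intro s hs
    have := norm_image_sub_le_of_norm_deriv_le_segment' (f := k) (f' := v) (C := D)
      (fun x hx => (hkv x hx).1.hasDerivWithinAt)
      (fun x hx => (hkv x (Set.Ico_subset_Icc_self hx)).2.2) s hs
    rw [hk0] at this
    nlinarith [hs.1, hs.2]
  have hsq : ∀ s ∈ Set.Icc (0 : ℝ) 1, ‖v s‖ ^ 2 ≤ D ^ 2 := fun s hs =>
    pow_le_pow_left₀ (norm_nonneg _) (hkv s hs).2.2 2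
  have hΓ : ∀ s ∈ Set.Icc (0 : ℝ) 1, ‖-Γ (k s) (v s) (v s)‖ ≤ (K + 1) * D ^ 2 := by
    intro s hs
    have h4 := hb₂ (k s) (by rw [mem_ball_iff_norm]; exact (hks s hs).trans_lt hD₂) (v s)
    have h5 := h₃ (v s)
    rw [norm_neg]
    calc ‖Γ (k s) (v s) (v s)‖
        ≤ ‖Γ (k s) (v s) (v s) - Γ u₀ (v s) (v s)‖ + ‖Γ u₀ (v s) (v s)‖ := by
          simpa using norm_add_le (Γ (k s) (v s) (v s) - Γ u₀ (v s) (v s)) (Γ u₀ (v s) (v s))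
      _ ≤ (K + 1) * ‖v s‖ ^ 2 := by linarith
      _ ≤ (K + 1) * D ^ 2 := by gcongr; exact (hkv s hs).2.2
  have hvs : ∀ s ∈ Set.Icc (0 : ℝ) 1, ‖v s - v 0‖ ≤ (K + 1) * D ^ 2 := by
    intro s hs
    have := norm_image_sub_le_of_norm_deriv_le_segment' (f := v) (C := (K + 1) * D ^ 2)
      (fun x hx => (hkv x hx).2.1.hasDerivWithinAt)
      (fun x hx => hΓ x (Set.Ico_subset_Icc_self hx)) s hs
    have h6 : 0 ≤ (K + 1) * D ^ 2 := by positivity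
    nlinarith [hs.1, hs.2]
  set A := Γ u₀ (v 0) (v 0)
  have hdiff : ∀ s ∈ Set.Icc (0 : ℝ) 1, ‖-Γ (k s) (v s) (v s) + A‖ ≤ η * D ^ 2 := by
    intro s hs
    have h4 := hb₁ (k s) (by rw [mem_ball_iff_norm]; exact (hks s hs).trans_lt hD₁) (v s)
    have h5 := h₁ (v s) (v 0)
    have h6 : ‖v s‖ + ‖v 0‖ ≤ 2 * D := by
      linarith [(hkv s hs).2.2, (hkv 0 (by simp)).2.2]
    have h7 : K * (‖v s - v 0‖ * (‖v s‖ + ‖v 0‖)) ≤ η / 2 * D ^ 2 := by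
      calc K * (‖v s - v 0‖ * (‖v s‖ + ‖v 0‖))
          ≤ (K + 1) * ((K + 1) * D ^ 2 * (2 * D)) := by
            gcongr
            · linarith
            · exact hvs s hs
        _ = 2 * ((K + 1) * (K + 1)) * D * D ^ 2 := by ring
        _ ≤ 2 * ((K + 1) * (K + 1)) * ρ₃ * D ^ 2 := by gcongr
        _ = η / 2 * D ^ 2 := by
            simp only [ρ₃]
            field_simp
            ring
    have h8 : -Γ (k s) (v s) (v s) + A =
        -((Γ (k s) (v s) (v s) - Γ u₀ (v s) (v s)) + (Γ u₀ (v s) (v s) - A)) := by abel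
    rw [h8, norm_neg]
    refine (norm_add_le _ _).trans ?_
    have := hsq s hs
    nlinarith
  -- The acceleration is within `η D²` of `-A`; two applications of the mean value inequality pass
  -- to the velocity and then to the position.
  have ha : ∀ s ∈ Set.Icc (0 : ℝ) 1, ‖v s - v 0 + s • A‖ ≤ η * D ^ 2 := by
    intro s hs
    have := norm_image_sub_le_of_norm_deriv_le_segment' (f := fun s => v s + s • A)
      (C := η * D ^ 2)
      (fun x hx => ((hkv x hx).2.1.add ((hasDerivAt_id x).smul_const A)).hasDerivWithinAt)
      (fun x hx => by simpa using hdiff x (Set.Ico_subset_Icc_self hx)) s hs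
    have h6 : 0 ≤ η * D ^ 2 := by positivity
    have h7 : v s + s • A - (v 0 + (0 : ℝ) • A) = v s - v 0 + s • A := by
      rw [zero_smul]; abel
    rw [h7] at this
    nlinarith [hs.1, hs.2]
  have hfin := norm_image_sub_le_of_norm_deriv_le_segment_01'
    (f := fun s => k s - s • v 0 + s ^ 2 • ((1 / 2 : ℝ) • A)) (f' := fun s => v s - v 0 + s • A)
    (C := η * D ^ 2)
    (fun x hx => (((hkv x hx).1.sub ((hasDerivAt_id x).smul_const (v 0))).add
      (((hasDerivAt_id x).pow 2).smul_const ((1 / 2 : ℝ) • A))).hasDerivWithinAt.congr_deriv (by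
        simp only [one_smul, id, smul_smul]
        congr 2
        norm_num
        ring))
    (fun x hx => ha x (Set.Ico_subset_Icc_self hx))
  convert hfin using 2
  rw [hk0]
  simp
  abel

end SecondOrderODE

/-! ### Geodesics and parallel covectors in a chart -/

section Geodesics

variable {d : ℕ} {M : Type*} [MetricSpace M] [ChartedSpace (Model d) M]
  [IsManifold 𝓘(ℝ, Model d) ∞ M]
  [RiemannianBundle (fun x : M => TangentSpace 𝓘(ℝ, Model d) x)]
  {e : OpenPartialHomeomorph M (Model d)}

theorem mdifferentiableAt_of_isGeodesic {γ : ℝ → M} (hγ : IsGeodesic d γ) (s : ℝ) :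
    MDifferentiableAt 𝓘(ℝ, ℝ) 𝓘(ℝ, Model d) γ s :=
  hγ.1.mdifferentiable (by simp) s

theorem eventually_mem_source {γ : ℝ → M} (hγ : IsGeodesic d γ) {s : ℝ} (hs : γ s ∈ e.source) :
    ∀ᶠ τ in 𝓝 s, γ τ ∈ e.source :=
  hγ.1.continuous.continuousAt.eventually (e.open_source.mem_nhds hs)

/-- The geodesic equation in the chart `e`. -/
theorem hasDerivAt_velocity (he : e ∈ IsManifold.maximalAtlas 𝓘(ℝ, Model d) ∞ M)
    {γ : ℝ → M} (hγ : IsGeodesic d γ) {s : ℝ} (hs : γ s ∈ e.source) :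
    HasDerivAt (fun τ => vecCoord e (velocity γ τ))
      (-christoffelForm e (e (γ s)) (vecCoord e (velocity γ s)) (vecCoord e (velocity γ s))) s := by
  set k : ℝ → Model d := fun τ => e (γ τ)
  have hk : ∀ᶠ τ in 𝓝 s, HasDerivAt k (vecCoord e (velocity γ τ)) τ := by
    filter_upwards [eventually_mem_source hγ hs] with τ hτ
    exact hasDerivAt_chart_comp he (mdifferentiableAt_of_isGeodesic hγ τ) hτ
  have hkd : deriv k =ᶠ[𝓝 s] fun τ => vecCoord e (velocity γ τ) := hk.mono fun τ h => h.deriv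
  have hsm : ContDiffAt ℝ ∞ k s := by
    rw [← contMDiffAt_iff_contDiffAt]
    exact (contMDiffAt_of_mem_maximalAtlas he hs).comp s hγ.1.contMDiffAt
  have hdd : DifferentiableAt ℝ (deriv k) s :=
    ((contDiffAt_infty.1 hsm 2).derivWithin (m := 1) (by norm_num)).differentiableAt (by simp)
  have hcomp : ∀ ρ, ∀ᶠ τ in 𝓝 s, HasDerivAt (fun τ => k τ ρ) (deriv k τ ρ) τ := by
    intro ρ
    filter_upwards [hk] with τ hτ
    rw [hτ.deriv]
    exact hasDerivAt_coord hτ ρ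
  have hmain := hdd.hasDerivAt
  have hval : deriv (deriv k) s =
      -christoffelForm e (e (γ s)) (vecCoord e (velocity γ s)) (vecCoord e (velocity γ s)) := by
    ext ρ
    have h1 := hγ.2 e he s hs ρ
    have h2 : ∀ α, deriv (fun τ => e (γ τ) α) s = vecCoord e (velocity γ s) α := fun α => by
      rw [← hk.self_of_nhds.deriv]
      exact (hcomp α).self_of_nhds.deriv
    have h3 : deriv (deriv (fun τ => e (γ τ) ρ)) s = deriv (deriv k) s ρ := by
      have : deriv (fun τ => e (γ τ) ρ) =ᶠ[𝓝 s] fun τ => deriv k τ ρ :=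
        (hcomp ρ).mono fun τ h => h.deriv
      rw [this.deriv_eq]
      exact (hasDerivAt_coord hmain ρ).deriv
    simp_rw [h3, h2] at h1
    rw [PiLp.neg_apply, christoffelForm_apply]
    linarith
  rw [← hval]
  exact hmain.congr_of_eventuallyEq hkd.symm

/-- The pairing of a parallel covector field with the velocity of a geodesic is constant. -/
theorem hasDerivAt_pairing {c : ℝ → CotangentBundle d M}
    (hγ : IsGeodesic d (fun s => (c s).proj)) (hc : IsParallelCovector c) (s : ℝ) :
    HasDerivAt (fun s => pairing (c s).2 (velocity (fun σ => (c σ).proj) s)) 0 s := by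
  set γ : ℝ → M := fun s => (c s).proj
  set e := chartAt (Model d) (γ s)
  have he : e ∈ IsManifold.maximalAtlas 𝓘(ℝ, Model d) ∞ M := IsManifold.chart_mem_maximalAtlas _
  have hs : γ s ∈ e.source := mem_chart_source _ _
  have hv := hasDerivAt_velocity he hγ hs
  set v : ℝ → Model d := fun τ => vecCoord e (velocity γ τ)
  have hvc : ∀ β, HasDerivAt (fun τ => v τ β) (-(christoffelForm e (e (γ s)) (v s) (v s)) β) s :=
    fun β => hasDerivAt_coord hv β
  have hk := hasDerivAt_chart_comp he (mdifferentiableAt_of_isGeodesic hγ s) hs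
  have hkc : ∀ α, deriv (fun τ => e (c τ).proj α) s = v s α := fun α =>
    (hasDerivAt_coord hk α).deriv
  have hm := hc e he s hs
  simp_rw [hkc] at hm
  have hsum := HasDerivAt.fun_sum (u := Finset.univ) fun β _ => (hm β).mul (hvc β)
  refine (hsum.congr_of_eventuallyEq ?_).congr_deriv ?_
  · filter_upwards [eventually_mem_source hγ hs] with τ hτ
    rw [pairing_eq_momForm he _ hτ, momForm_apply]
    rfl
  -- The derivatives of the covector and of the velocity contribute `ζ(Γ(v, v))` with opposite
  -- signs; the sums agree after renaming indices.
  · rw [Finset.sum_add_distrib]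
    simp_rw [christoffelForm_apply, mul_neg, Finset.sum_neg_distrib, Finset.sum_mul,
      Finset.mul_sum]
    rw [← sub_eq_add_neg, sub_eq_zero]
    rw [Finset.sum_comm_cycle]
    refine Finset.sum_congr rfl fun ρ _ => ?_
    rw [Finset.sum_comm]
    refine Finset.sum_congr rfl fun α _ => Finset.sum_congr rfl fun β _ => ?_
    simp only [γ]
    ring

end Geodesics

/-! ### Constant speed, length, and the line integral -/

section Metric

variable {d : ℕ} {M : Type*} [MetricSpace M] [ChartedSpace (Model d) M]
  [IsManifold 𝓘(ℝ, Model d) ∞ M]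
  [RiemannianBundle (fun x : M => TangentSpace 𝓘(ℝ, Model d) x)]
  [IsContMDiffRiemannianBundle 𝓘(ℝ, Model d) ∞ (Model d)
      (fun x : M => TangentSpace 𝓘(ℝ, Model d) x)]
  {e : OpenPartialHomeomorph M (Model d)}

theorem differentiableAt_gLow (he : e ∈ IsManifold.maximalAtlas 𝓘(ℝ, Model d) ∞ M) {u : Model d}
    (hu : u ∈ e.target) (α β : Fin d) : DifferentiableAt ℝ (fun u => gLow e u α β) u :=
  ((contDiffOn_gLow he α β).contDiffAt (e.open_target.mem_nhds hu)).differentiableAt (by simp)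

theorem continuousOn_gUp (he : e ∈ IsManifold.maximalAtlas 𝓘(ℝ, Model d) ∞ M) (α β : Fin d) :
    ContinuousOn (fun u => gUp e u α β) e.target := by
  have hc : ContinuousOn (gLow e) e.target :=
    continuousOn_pi.2 fun α => continuousOn_pi.2 fun β => (contDiffOn_gLow he α β).continuousOn
  have : ContinuousOn (fun u => (gLow e u)⁻¹) e.target := by
    simp_rw [Matrix.inv_def, Ring.inverse_eq_inv']
    refine ContinuousOn.smul (ContinuousOn.inv₀
      (continuous_id.matrix_det.comp_continuousOn hc) fun u hu => ?_)
      (continuous_id.matrix_adjugate.comp_continuousOn hc)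
    exact (gLow_posDef he hu).det_pos.ne'
  exact continuousOn_pi.1 (continuousOn_pi.1 this α) β

theorem continuousOn_partialD_gLow (he : e ∈ IsManifold.maximalAtlas 𝓘(ℝ, Model d) ∞ M)
    (α β σ : Fin d) : ContinuousOn (partialD (fun u => gLow e u α β) σ) e.target := by
  have := (contDiffOn_gLow he α β).continuousOn_fderiv_of_isOpen e.open_target (by simp)
  exact (this.clm_apply (continuousOn_const (c := EuclideanSpace.single σ (1 : ℝ)))).congr
    fun u hu => partialD_eq_fderiv (differentiableAt_gLow he hu α β) σ

theorem continuousOn_christoffel (he : e ∈ IsManifold.maximalAtlas 𝓘(ℝ, Model d) ∞ M)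
    (ρ α β : Fin d) : ContinuousOn (fun u => christoffel e u ρ α β) e.target := by
  refine ContinuousOn.mul continuousOn_const (continuousOn_finsetSum _ fun σ _ => ?_)
  exact (continuousOn_gUp he ρ σ).mul (((continuousOn_partialD_gLow he _ _ _).add
    (continuousOn_partialD_gLow he _ _ _)).sub (continuousOn_partialD_gLow he _ _ _))

theorem sum_gLow_mul_gUp (he : e ∈ IsManifold.maximalAtlas 𝓘(ℝ, Model d) ∞ M) {u : Model d}
    (hu : u ∈ e.target) (f : Fin d → ℝ) (μ : Fin d) :
    ∑ ρ, gLow e u μ ρ * ∑ σ, gUp e u ρ σ * f σ = f μ := by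
  have h : gLow e u * gUp e u = 1 := Matrix.mul_nonsing_inv _
    ((Matrix.isUnit_iff_isUnit_det _).1 (gLow_posDef he hu).isUnit)
  have := congrFun (congrArg (fun A : Matrix (Fin d) (Fin d) ℝ => A *ᵥ f) h) μ
  simp only [← Matrix.mulVec_mulVec, Matrix.one_mulVec] at this
  exact this

theorem sum_gLow_mul_christoffel (he : e ∈ IsManifold.maximalAtlas 𝓘(ℝ, Model d) ∞ M)
    {u : Model d} (hu : u ∈ e.target) (μ α β : Fin d) :
    ∑ ρ, gLow e u μ ρ * christoffel e u ρ α β = (1 / 2) *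
      (partialD (fun v => gLow e v μ β) α u + partialD (fun v => gLow e v μ α) β u
      - partialD (fun v => gLow e v α β) μ u) := by
  rw [← sum_gLow_mul_gUp he hu (fun σ => (partialD (fun v => gLow e v σ β) α u +
    partialD (fun v => gLow e v σ α) β u - partialD (fun v => gLow e v α β) σ u)) μ,
    Finset.mul_sum]
  refine Finset.sum_congr rfl fun ρ _ => ?_
  rw [christoffel]
  ring

/-- Compatibility of the connection with the metric on the diagonal. With all arguments equal, the
three metric derivatives in the Christoffel symbol become the same sum `T`, and `T + T - T = T`.
This is the cancellation behind constant speed. -/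
theorem two_mul_metricForm_christoffelForm (he : e ∈ IsManifold.maximalAtlas 𝓘(ℝ, Model d) ∞ M)
    {u : Model d} (hu : u ∈ e.target) (a : Model d) :
    2 * metricForm e u a (christoffelForm e u a a) =
      ∑ α, ∑ β, ∑ σ, partialD (fun v => gLow e v α β) σ u * a σ * a α * a β := by
  have h1 : metricForm e u a (christoffelForm e u a a) =
      ∑ μ, ∑ α, ∑ β, (∑ ρ, gLow e u μ ρ * christoffel e u ρ α β) * a α * a β * a μ := by
    rw [metricForm_apply]
    refine Finset.sum_congr rfl fun μ _ => ?_
    simp_rw [christoffelForm_apply, Finset.mul_sum, Finset.sum_mul]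
    rw [Finset.sum_comm]
    refine Finset.sum_congr rfl fun α _ => ?_
    rw [Finset.sum_comm]
    refine Finset.sum_congr rfl fun β _ => Finset.sum_congr rfl fun ρ _ => ?_
    ring
  set T : Fin d → Fin d → Fin d → ℝ := fun α β σ =>
    partialD (fun v => gLow e v α β) σ u * a σ * a α * a β with hT
  have h2 : ∑ μ, ∑ α, ∑ β, T μ β α = ∑ α, ∑ β, ∑ σ, T α β σ :=
    Finset.sum_congr rfl fun μ _ => Finset.sum_comm
  have h3 : ∑ μ, ∑ α, ∑ β, T α β μ = ∑ α, ∑ β, ∑ σ, T α β σ := by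
    rw [Finset.sum_comm]
    exact Finset.sum_congr rfl fun μ _ => Finset.sum_comm
  have h4 : 2 * ∑ μ, ∑ α, ∑ β, (∑ ρ, gLow e u μ ρ * christoffel e u ρ α β) * a α * a β * a μ =
      ∑ μ, ∑ α, ∑ β, T μ β α + ∑ μ, ∑ α, ∑ β, T μ α β - ∑ μ, ∑ α, ∑ β, T α β μ := by
    simp_rw [sum_gLow_mul_christoffel he hu, Finset.mul_sum, ← Finset.sum_add_distrib,
      ← Finset.sum_sub_distrib]
    refine Finset.sum_congr rfl fun μ _ => Finset.sum_congr rfl fun α _ =>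
      Finset.sum_congr rfl fun β _ => ?_
    simp only [hT]
    ring
  rw [h1, h4, h2, h3]
  ring

/-- Geodesics have constant speed. -/
theorem hasDerivAt_inner_velocity {γ : ℝ → M} (hγ : IsGeodesic d γ) (s : ℝ) :
    HasDerivAt (fun s => inner ℝ (velocity (d := d) γ s) (velocity (d := d) γ s)) 0 s := by
  set e := chartAt (Model d) (γ s)
  have he : e ∈ IsManifold.maximalAtlas 𝓘(ℝ, Model d) ∞ M := IsManifold.chart_mem_maximalAtlas _
  have hs : γ s ∈ e.source := mem_chart_source _ _
  have h := hasDerivAt_bilinearForm (g := gLow e) (k := fun τ => e (γ τ))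
    (v := fun τ => vecCoord e (velocity γ τ)) (fun u α β => gLow_comm u α β)
    (fun α β => differentiableAt_gLow he (e.map_source hs) α β)
    (hasDerivAt_chart_comp he (mdifferentiableAt_of_isGeodesic hγ s) hs)
    (hasDerivAt_velocity he hγ hs)
  refine (h.congr_of_eventuallyEq ?_).congr_deriv ?_
  · filter_upwards [eventually_mem_source hγ hs] with τ hτ
    exact inner_eq_metricForm he hτ _ _
  · rw [← two_mul_metricForm_christoffelForm he (e.map_source hs)]
    simp [metricForm, bilinearForm]

theorem norm_velocity_eq {γ : ℝ → M} (hγ : IsGeodesic d γ) (s s' : ℝ) :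
    ‖(velocity γ s : TangentSpace 𝓘(ℝ, Model d) (γ s))‖ =
      ‖(velocity γ s' : TangentSpace 𝓘(ℝ, Model d) (γ s'))‖ := by
  have h := is_const_of_deriv_eq_zero
    (f := fun s => inner ℝ (velocity (d := d) γ s) (velocity (d := d) γ s))
    (fun s => (hasDerivAt_inner_velocity hγ s).differentiableAt)
    (fun s => (hasDerivAt_inner_velocity hγ s).deriv) s s'
  simp only [real_inner_self_eq_norm_sq] at h
  exact (sq_eq_sq₀ (norm_nonneg _) (norm_nonneg _)).1 h

/-- The speed is constant and the parameter interval has length 1, so the speed is the length. -/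
theorem norm_velocity_of_isShortestGeodesic {γ : ℝ → M} {z x : M}
    (hγ : IsShortestGeodesic d γ z x) (s : ℝ) :
    ‖(velocity γ s : TangentSpace 𝓘(ℝ, Model d) (γ s))‖ = dist z x := by
  have h := hγ.2.2.2
  rw [pathELength_eq_lintegral_mfderiv_Icc] at h
  have h2 : ∀ τ, ‖mfderiv 𝓘(ℝ, ℝ) 𝓘(ℝ, Model d) γ τ (1 : ℝ)‖ₑ =
      ENNReal.ofReal ‖(velocity γ s : TangentSpace 𝓘(ℝ, Model d) (γ s))‖ := fun τ => by
    rw [← norm_velocity_eq hγ.1 τ s, ofReal_norm]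
    rfl
  replace h := (MeasureTheory.lintegral_congr (fun τ => (h2 τ).symm)).trans h
  simp only [MeasureTheory.lintegral_const, MeasureTheory.Measure.restrict_apply_univ,
    Real.volume_Icc, sub_zero, ENNReal.ofReal_one, mul_one, edist_dist] at h
  exact (ENNReal.ofReal_eq_ofReal_iff (norm_nonneg _) dist_nonneg).1 h

/-- An initial arc is no longer than the whole curve. This confines short geodesics to a ball inside
the chart. -/
theorem dist_le_of_isShortestGeodesic [IsRiemannianManifold 𝓘(ℝ, Model d) M] {γ : ℝ → M} {z x : M}
    (hγ : IsShortestGeodesic d γ z x) {s : ℝ} (hs : s ∈ Set.Icc (0 : ℝ) 1) :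
    dist (γ s) z ≤ dist z x := by
  have h1 : edist z (γ s) ≤ edist z x := by
    rw [IsRiemannianManifold.out (I := 𝓘(ℝ, Model d)) z (γ s), ← hγ.2.2.2]
    exact (riemannianEDist_le_pathELength (hγ.1.1.of_le (by simp)).contMDiffOn hγ.2.1 rfl
      hs.1).trans (pathELength_mono le_rfl hs.2)
  rw [edist_dist, edist_dist] at h1
  rw [dist_comm]
  exact (ENNReal.ofReal_le_ofReal_iff dist_nonneg).1 h1

theorem integral_pairing {c : ℝ → CotangentBundle d M}
    (hγ : IsGeodesic d (fun s => (c s).proj)) (hc : IsParallelCovector c) :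
    ∫ s in (0 : ℝ)..1, pairing (c s).2 (velocity (fun σ => (c σ).proj) s) =
      pairing (c 0).2 (velocity (fun σ => (c σ).proj) 0) := by
  have h : ∀ s, pairing (c s).2 (velocity (fun σ => (c σ).proj) s) =
      pairing (c 0).2 (velocity (fun σ => (c σ).proj) 0) := fun s =>
    is_const_of_deriv_eq_zero (fun s => (hasDerivAt_pairing hγ hc s).differentiableAt)
      (fun s => (hasDerivAt_pairing hγ hc s).deriv) s 0
  simp [h]

end Metric

/-! ### From initial velocity to displacement -/

section Expansion

variable {E : Type*} [NormedAddCommGroup E] [NormedSpace ℝ E]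

/-- Here `v` is the initial velocity and `D` the distance. Substituting `v = w + G v / 2 - R`, with
`w = u - u₀`, makes `ξ v` quadratic up to `ξ R`. Since `v - w = O(D²)`, replacing `v` by `w` in `G`
and `g` costs `O(D³)`, and `D = O(‖w‖)`. -/
theorem isLittleO_of_forall_expansion {f : E → ℂ} {u₀ : E} {ξ : E →L[ℝ] ℝ} {G : E → E}
    {g : E → ℝ} {K C κ : ℝ} (hK : 0 ≤ K) (hC : 0 ≤ C)
    (hG : ∀ a b, ‖G a - G b‖ ≤ K * (‖a - b‖ * (‖a‖ + ‖b‖))) (hG' : ∀ a, ‖G a‖ ≤ K * ‖a‖ ^ 2)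
    (hg : ∀ a b, ‖g a - g b‖ ≤ K * (‖a - b‖ * (‖a‖ + ‖b‖))) (hg' : ∀ a, ‖g a‖ ≤ K * ‖a‖ ^ 2)
    (h : ∀ η > 0, ∀ᶠ u in 𝓝 u₀, ∃ v : E, ∃ D : ℝ, 0 ≤ D ∧ D ≤ η ∧ ‖v‖ ≤ C * D ∧ g v = D ^ 2 ∧
      ‖u - u₀ - v + (1 / 2 : ℝ) • G v‖ ≤ η * D ^ 2 ∧
      f u = (ξ v : ℂ) + Complex.I * κ / 2 * (D : ℂ) ^ 2) :
    (fun u => f u - (ξ (u - u₀) : ℂ) - (((1 / 2 * ξ (G (u - u₀)) : ℝ) : ℂ) +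
      Complex.I * κ / 2 * (g (u - u₀) : ℂ))) =o[𝓝 u₀] fun u => ‖u - u₀‖ ^ 2 := by
  rw [Asymptotics.isLittleO_iff]
  intro c hc
  -- `A` bounds `‖v - w‖ / D²`; `B` below collects the total error as `η B D²`.
  set A := K * C ^ 2 / 2 + 1 with hA
  have hA1 : 1 ≤ A := by
    have : 0 ≤ K * C ^ 2 / 2 := by positivity
    linarith
  set B := ‖ξ‖ + (‖ξ‖ + |κ|) * K * A * (2 * C + A) with hB
  have hB0 : 0 ≤ B := by positivity
  obtain ⟨η, hη, hη1, hη2, hη3⟩ : ∃ η : ℝ, 0 < η ∧ η ≤ 1 ∧ η * ((K + 1) * A) ≤ 1 / 2 ∧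
      η * (B * (2 * (K + 1)) ^ 2) ≤ c := by
    have e1 : ∀ b : ℝ, 0 < b → ∀ a : ℝ, ∀ᶠ η : ℝ in 𝓝[>] 0, η * a ≤ b := by
      intro b hb a
      have : Tendsto (fun η : ℝ => η * a) (𝓝[>] 0) (𝓝 0) := by
        have : Continuous fun η : ℝ => η * a := by fun_prop
        simpa using (this.tendsto 0).mono_left nhdsWithin_le_nhds
      exact (this.eventually (gt_mem_nhds hb)).mono fun _ h => h.le
    have e0 : ∀ᶠ η : ℝ in 𝓝[>] 0, 0 < η := self_mem_nhdsWithin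
    obtain ⟨η, h1, h2, h3, h4⟩ := (e0.and ((e1 1 one_pos 1).and
      ((e1 (1 / 2) (by norm_num) ((K + 1) * A)).and (e1 c hc (B * (2 * (K + 1)) ^ 2))))).exists
    exact ⟨η, h1, by simpa using h2, h3, h4⟩
  filter_upwards [h η hη] with u ⟨v, D, hD0, hDη, hvD, hgv, hR, hf⟩
  set w := u - u₀
  set R := w - v + (1 / 2 : ℝ) • G v with hRdef
  have hGv : ‖G v‖ ≤ K * C ^ 2 * D ^ 2 := by
    refine (hG' v).trans ?_
    rw [mul_assoc, ← mul_pow]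
    gcongr
  have hvw : ‖v - w‖ ≤ A * D ^ 2 := by
    have h1 : v - w = (1 / 2 : ℝ) • G v - R := by rw [hRdef]; abel
    rw [h1]
    refine (norm_sub_le _ _).trans ?_
    rw [norm_smul]
    have : ‖R‖ ≤ 1 * D ^ 2 := hR.trans (by gcongr)
    norm_num
    rw [hA]
    linarith
  -- `D² = g v ≤ K ‖v‖²`, and `K ≤ (K + 1)²` avoids a square root.
  have hDv : D ≤ (K + 1) * ‖v‖ := by
    refine abs_le_of_sq_le_sq' ?_ (by positivity) |>.2
    rw [← hgv]
    refine (le_abs_self _).trans ((hg' v).trans ?_)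
    rw [mul_pow]
    gcongr
    nlinarith
  -- The error `A D²` is absorbed into `D / 2`, as `D ≤ η` is small.
  have hDw : D ≤ 2 * (K + 1) * ‖w‖ := by
    have h1 : ‖v‖ ≤ ‖w‖ + ‖v - w‖ := by
      simpa using norm_add_le w (v - w)
    have h2 : (K + 1) * (A * D ^ 2) ≤ 1 / 2 * D := by
      calc (K + 1) * (A * D ^ 2) = D * ((K + 1) * A) * D := by ring
        _ ≤ η * ((K + 1) * A) * D := by gcongr
        _ ≤ 1 / 2 * D := by gcongr
    have h3 : (K + 1) * ‖v‖ ≤ (K + 1) * (‖w‖ + A * D ^ 2) := by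
      gcongr
      linarith
    linarith
  have hsum : ‖v‖ + ‖w‖ ≤ (2 * C + A) * η := by
    have h1 : ‖w‖ ≤ ‖v‖ + ‖v - w‖ := by
      simpa using norm_sub_le v (v - w)
    have h2 : A * D ^ 2 ≤ A * D := by
      have : D ^ 2 ≤ D := by nlinarith
      gcongr
    calc ‖v‖ + ‖w‖ ≤ (2 * C + A) * D := by linarith
      _ ≤ _ := by gcongr
  have hprod : K * (‖v - w‖ * (‖v‖ + ‖w‖)) ≤ K * A * (2 * C + A) * η * D ^ 2 := by
    calc K * (‖v - w‖ * (‖v‖ + ‖w‖)) ≤ K * ((A * D ^ 2) * ((2 * C + A) * η)) := by gcongr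
      _ = _ := by ring
  have hid : f u - (ξ w : ℂ) - (((1 / 2 * ξ (G w) : ℝ) : ℂ) + Complex.I * κ / 2 * (g w : ℂ)) =
      ((-ξ R + 1 / 2 * ξ (G v - G w) : ℝ) : ℂ) + Complex.I * κ / 2 * ((g v - g w : ℝ) : ℂ) := by
    rw [hf, hRdef]
    simp only [map_add, map_sub, map_smul, hgv, smul_eq_mul]
    push_cast
    ring
  rw [hid]
  have hn1 : ‖((-ξ R + 1 / 2 * ξ (G v - G w) : ℝ) : ℂ)‖ ≤
      ‖ξ‖ * (η * D ^ 2) + ‖ξ‖ * (K * (‖v - w‖ * (‖v‖ + ‖w‖))) := by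
    rw [Complex.norm_real]
    refine (norm_add_le _ _).trans (add_le_add ?_ ?_)
    · rw [norm_neg]
      exact (ξ.le_opNorm R).trans (by gcongr)
    · rw [norm_mul]
      have h1 := (ξ.le_opNorm (G v - G w)).trans
        (mul_le_mul_of_nonneg_left (hG v w) (norm_nonneg ξ))
      have h2 : ‖(1 / 2 : ℝ)‖ ≤ 1 := by norm_num
      calc ‖(1 / 2 : ℝ)‖ * ‖ξ (G v - G w)‖ ≤ 1 * ‖ξ (G v - G w)‖ := by gcongr
        _ ≤ _ := by linarith
  have hn2 : ‖Complex.I * κ / 2 * ((g v - g w : ℝ) : ℂ)‖ ≤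
      |κ| * (K * (‖v - w‖ * (‖v‖ + ‖w‖))) := by
    rw [norm_mul, Complex.norm_real]
    have h2 : ‖Complex.I * κ / 2‖ ≤ |κ| := by
      simp only [norm_div, norm_mul, Complex.norm_I, one_mul, Complex.norm_real, Real.norm_eq_abs]
      norm_num
    gcongr
    exact hg v w
  calc _ ≤ _ := norm_add_le _ _
    _ ≤ ‖ξ‖ * (η * D ^ 2) + ‖ξ‖ * (K * A * (2 * C + A) * η * D ^ 2) +
        |κ| * (K * A * (2 * C + A) * η * D ^ 2) := by
        refine (add_le_add hn1 hn2).trans ?_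
        gcongr
    _ = η * B * D ^ 2 := by rw [hB]; ring
    _ ≤ η * B * (2 * (K + 1) * ‖w‖) ^ 2 := by gcongr
    _ = η * (B * (2 * (K + 1)) ^ 2) * ‖w‖ ^ 2 := by ring
    _ ≤ c * ‖w‖ ^ 2 := by gcongr
    _ = c * ‖‖w‖ ^ 2‖ := by simp

end Expansion

/-! ### Algebra and bounds for the coordinate forms -/

section Forms

variable {d : ℕ}

theorem bilinearForm_eq_sum (g : Matrix (Fin d) (Fin d) ℝ) (a b : Model d) :
    bilinearForm g a b = ∑ i : Fin d × Fin d, g i.1 i.2 *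
      (EuclideanSpace.proj i.1 : Model d →L[ℝ] ℝ) a *
      (EuclideanSpace.proj i.2 : Model d →L[ℝ] ℝ) b := by
  rw [Fintype.sum_prod_type]
  rfl

theorem bilinearMap_eq_sum (c : Fin d → Fin d → Fin d → ℝ) (a b : Model d) :
    bilinearMap c a b = ∑ i : Fin d × Fin d × Fin d, (c i.1 i.2.1 i.2.2 *
      (EuclideanSpace.proj i.2.1 : Model d →L[ℝ] ℝ) a *
      (EuclideanSpace.proj i.2.2 : Model d →L[ℝ] ℝ) b) • EuclideanSpace.single i.1 (1 : ℝ) := by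
  rw [Fintype.sum_prod_type]
  simp_rw [Fintype.sum_prod_type]
  rfl

theorem bilinearForm_smul_smul (g : Matrix (Fin d) (Fin d) ℝ) (r : ℝ) (a : Model d) :
    bilinearForm g (r • a) (r • a) = r ^ 2 * bilinearForm g a a := by
  simp only [bilinearForm, Finset.mul_sum, PiLp.smul_apply, smul_eq_mul]
  refine Finset.sum_congr rfl fun α _ => Finset.sum_congr rfl fun β _ => ?_
  ring

theorem bilinearMap_smul_smul (c : Fin d → Fin d → Fin d → ℝ) (r : ℝ) (a : Model d) :
    bilinearMap c (r • a) (r • a) = r ^ 2 • bilinearMap c a a := by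
  ext ρ
  simp only [bilinearMap_apply, Finset.mul_sum, PiLp.smul_apply, smul_eq_mul]
  refine Finset.sum_congr rfl fun α _ => Finset.sum_congr rfl fun β _ => ?_
  ring

theorem bilinearForm_add_add (g : Matrix (Fin d) (Fin d) ℝ) (a b : Model d) :
    bilinearForm g (a + b) (a + b) = bilinearForm g a a + bilinearForm g a b +
      bilinearForm g b a + bilinearForm g b b := by
  simp only [bilinearForm, PiLp.add_apply, ← Finset.sum_add_distrib]
  refine Finset.sum_congr rfl fun α _ => Finset.sum_congr rfl fun β _ => ?_
  ring

theorem bilinearMap_add_add (c : Fin d → Fin d → Fin d → ℝ) (a b : Model d) :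
    bilinearMap c (a + b) (a + b) = bilinearMap c a a + bilinearMap c a b +
      bilinearMap c b a + bilinearMap c b b := by
  ext ρ
  simp only [bilinearMap_apply, PiLp.add_apply, ← Finset.sum_add_distrib]
  refine Finset.sum_congr rfl fun α _ => Finset.sum_congr rfl fun β _ => ?_
  ring

theorem exists_bound_bilinearForm (g : Matrix (Fin d) (Fin d) ℝ) : ∃ K, 0 ≤ K ∧
    (∀ a b, ‖bilinearForm g a a - bilinearForm g b b‖ ≤ K * (‖a - b‖ * (‖a‖ + ‖b‖))) ∧
    ∀ a, ‖bilinearForm g a a‖ ≤ K * ‖a‖ ^ 2 := by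
  have h := exists_bound_sum_bilinear (E := Model d) (fun i : Fin d × Fin d => g i.1 i.2)
    (fun i => EuclideanSpace.proj i.1) (fun i => EuclideanSpace.proj i.2) fun _ => (1 : ℝ)
  simp_rw [smul_eq_mul, mul_one, ← bilinearForm_eq_sum] at h
  exact h

theorem exists_bound_bilinearMap (c : Fin d → Fin d → Fin d → ℝ) : ∃ K, 0 ≤ K ∧
    (∀ a b, ‖bilinearMap c a a - bilinearMap c b b‖ ≤ K * (‖a - b‖ * (‖a‖ + ‖b‖))) ∧
    ∀ a, ‖bilinearMap c a a‖ ≤ K * ‖a‖ ^ 2 := by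
  have h := exists_bound_sum_bilinear (E := Model d)
    (fun i : Fin d × Fin d × Fin d => c i.1 i.2.1 i.2.2)
    (fun i => EuclideanSpace.proj i.2.1) (fun i => EuclideanSpace.proj i.2.2)
    fun i => EuclideanSpace.single i.1 (1 : ℝ)
  simp_rw [← bilinearMap_eq_sum] at h
  exact h

end Forms

/-! ### Short shortest geodesics in a chart -/

section ShortGeodesics

variable {d : ℕ} {M : Type*} [MetricSpace M] [ChartedSpace (Model d) M]
  [IsManifold 𝓘(ℝ, Model d) ∞ M]
  [RiemannianBundle (fun x : M => TangentSpace 𝓘(ℝ, Model d) x)]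
  [IsContMDiffRiemannianBundle 𝓘(ℝ, Model d) ∞ (Model d)
      (fun x : M => TangentSpace 𝓘(ℝ, Model d) x)]
  {e : OpenPartialHomeomorph M (Model d)}

theorem eventually_norm_christoffelForm_sub_le
    (he : e ∈ IsManifold.maximalAtlas 𝓘(ℝ, Model d) ∞ M) {u₀ : Model d} (hu : u₀ ∈ e.target)
    {η : ℝ} (hη : 0 < η) :
    ∀ᶠ u in 𝓝 u₀, ∀ a, ‖christoffelForm e u a a - christoffelForm e u₀ a a‖ ≤ η * ‖a‖ ^ 2 := by
  have h := eventually_norm_sum_bilinear_sub_le (E := Model d) (F := Model d) (u₀ := u₀)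
    (c := fun (i : Fin d × Fin d × Fin d) u => christoffel e u i.1 i.2.1 i.2.2)
    (fun i => (continuousOn_christoffel he _ _ _).continuousAt (e.open_target.mem_nhds hu))
    (fun i => EuclideanSpace.proj i.2.1) (fun i => EuclideanSpace.proj i.2.2)
    (fun i => EuclideanSpace.single i.1 (1 : ℝ)) hη
  filter_upwards [h] with u hu a
  unfold christoffelForm
  rw [bilinearMap_eq_sum, bilinearMap_eq_sum, sq]
  exact hu a a

theorem exists_eventually_le_metricForm
    (he : e ∈ IsManifold.maximalAtlas 𝓘(ℝ, Model d) ∞ M) {u₀ : Model d} (hu : u₀ ∈ e.target) :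
    ∃ κ > 0, ∀ᶠ u in 𝓝 u₀, ∀ a, κ * ‖a‖ ^ 2 ≤ metricForm e u a a := by
  have h := exists_eventually_le_sum_quadratic (E := Model d) (u₀ := u₀)
    (c := fun (i : Fin d × Fin d) u => gLow e u i.1 i.2)
    (fun i => (contDiffOn_gLow he _ _).continuousOn.continuousAt (e.open_target.mem_nhds hu))
    (fun i => EuclideanSpace.proj i.1) (fun i => EuclideanSpace.proj i.2)
    (fun a ha => by
      rw [← bilinearForm_eq_sum]
      exact metricForm_pos he hu ha)
  simp_rw [← bilinearForm_eq_sum (gLow e _)] at h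
  exact h

variable [IsRiemannianManifold 𝓘(ℝ, Model d) M]

/-- Short shortest geodesics from `z`, in a chart. -/
theorem exists_shortestGeodesic_expansion
    (he : e ∈ IsManifold.maximalAtlas 𝓘(ℝ, Model d) ∞ M) {z : M} (hz : z ∈ e.source) :
    ∃ C : ℝ, 0 ≤ C ∧ ∀ η > 0, ∃ ρ > 0, ∀ (γ : ℝ → M) (x : M), IsShortestGeodesic d γ z x →
      dist z x < ρ →
      ‖vecCoord e (velocity γ 0)‖ ≤ C * dist z x ∧
      metricForm e (e z) (vecCoord e (velocity γ 0)) (vecCoord e (velocity γ 0)) =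
        dist z x ^ 2 ∧
      ‖e x - e z - vecCoord e (velocity γ 0) + (1 / 2 : ℝ) • christoffelForm e (e z)
        (vecCoord e (velocity γ 0)) (vecCoord e (velocity γ 0))‖ ≤ η * dist z x ^ 2 := by
  have hu := e.map_source hz
  obtain ⟨κ, hκ, hev⟩ := exists_eventually_le_metricForm he hu
  obtain ⟨K, hK, h₁, h₃⟩ := exists_bound_bilinearMap (christoffel e (e z))
  set C := (Real.sqrt κ)⁻¹
  have hC : 0 < C := by positivity
  have hev2 : ∀ᶠ x in 𝓝 z, x ∈ e.source ∧ ∀ a, κ * ‖a‖ ^ 2 ≤ metricForm e (e x) a a :=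
    (e.open_source.eventually_mem hz).and ((e.continuousAt hz).eventually hev)
  obtain ⟨ρ₁, hρ₁, hball⟩ := Metric.eventually_nhds_iff_ball.1 hev2
  refine ⟨C, hC.le, fun η hη => ?_⟩
  -- The coordinate speed is bounded by `C * dist z x`, so the tolerance is divided by `C²`.
  obtain ⟨ρ₂, hρ₂, hode⟩ := exists_forall_geodesic_expansion (E := Model d)
    (Γ := christoffelForm e) (u₀ := e z) hK h₁
    (fun η hη => eventually_norm_christoffelForm_sub_le he hu hη) h₃
    (show 0 < η / C ^ 2 by positivity)
  refine ⟨min ρ₁ (ρ₂ / C), by positivity, fun γ x hγ hx => ?_⟩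
  have hmem : ∀ s ∈ Set.Icc (0 : ℝ) 1, γ s ∈ e.source ∧
      ∀ a, κ * ‖a‖ ^ 2 ≤ metricForm e (e (γ s)) a a := fun s hs =>
    hball _ ((dist_le_of_isShortestGeodesic hγ hs).trans_lt (hx.trans_le (min_le_left _ _)))
  have hmet : ∀ s ∈ Set.Icc (0 : ℝ) 1, metricForm e (e (γ s)) (vecCoord e (velocity γ s))
      (vecCoord e (velocity γ s)) = dist z x ^ 2 := fun s hs => by
    rw [← inner_eq_metricForm he (hmem s hs).1, real_inner_self_eq_norm_sq,
      norm_velocity_of_isShortestGeodesic hγ]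
  have hspeed : ∀ s ∈ Set.Icc (0 : ℝ) 1, ‖vecCoord e (velocity γ s)‖ ≤ C * dist z x := by
    intro s hs
    have h4 := (hmem s hs).2 (vecCoord e (velocity γ s))
    rw [hmet s hs] at h4
    have h5 : (Real.sqrt κ * ‖vecCoord e (velocity γ s)‖) ^ 2 ≤ dist z x ^ 2 := by
      rw [mul_pow, Real.sq_sqrt hκ.le]
      exact h4
    have h6 := (abs_le_of_sq_le_sq' h5 dist_nonneg).2
    rwa [le_inv_mul_iff₀' (by positivity), mul_comm]
  have h0 : (0 : ℝ) ∈ Set.Icc (0 : ℝ) 1 := by simp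
  refine ⟨hspeed 0 h0, by simpa [hγ.2.1] using hmet 0 h0, ?_⟩
  have hfin := hode (C * dist z x)
    (by
      have := hx.trans_le (min_le_right _ _)
      rwa [lt_div_iff₀' hC] at this)
    (fun s => e (γ s)) (fun s => vecCoord e (velocity γ s)) (by simp [hγ.2.1])
    fun s hs => ⟨hasDerivAt_chart_comp he (mdifferentiableAt_of_isGeodesic hγ.1 s) (hmem s hs).1,
      hasDerivAt_velocity he hγ.1 (hmem s hs).1, hspeed s hs⟩
  simp only [hγ.2.2.1] at hfin
  refine hfin.trans (le_of_eq ?_)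
  rw [mul_pow, ← mul_assoc, div_mul_cancel₀ _ (by positivity)]

end ShortGeodesics

/-! ### Gradient and Hessian of the phase at `x*` -/

section Phase

variable {d : ℕ} {M : Type*} [MetricSpace M] [ChartedSpace (Model d) M]
  [IsManifold 𝓘(ℝ, Model d) ∞ M]
  [RiemannianBundle (fun x : M => TangentSpace 𝓘(ℝ, Model d) x)]
  [IsContMDiffRiemannianBundle 𝓘(ℝ, Model d) ∞ (Model d)
      (fun x : M => TangentSpace 𝓘(ℝ, Model d) x)]
  [IsRiemannianManifold 𝓘(ℝ, Model d) M]
  {e : OpenPartialHomeomorph M (Model d)}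
  {Φ : ℝ → CotangentBundle d M → CotangentBundle d M} {ε : ℝ}
  {φ : ℝ → M → CotangentBundle d M → ℂ}

/-- The second order Taylor expansion of the phase function at `x = x*`. -/
theorem fderiv_phase_eq (hφ : IsLeviCivitaPhase Φ ε φ) (t : ℝ) {p : CotangentBundle d M}
    (hp : p.2 ≠ 0) (he : e ∈ IsManifold.maximalAtlas 𝓘(ℝ, Model d) ∞ M)
    (hz : (Φ t p).proj ∈ e.source)
    (hf : ContDiffAt ℝ 2 (fun u => φ t (e.symm u) p) (e (Φ t p).proj)) (a b : Model d) :
    fderiv ℝ (fun u => φ t (e.symm u) p) (e (Φ t p).proj) a = (momForm e (Φ t p) a : ℂ) ∧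
    fderiv ℝ (fun w => fderiv ℝ (fun u => φ t (e.symm u) p) w a) (e (Φ t p).proj) b =
      (momForm e (Φ t p) (christoffelForm e (e (Φ t p).proj) a b) : ℂ) +
      Complex.I * ((ε * ham p : ℝ) : ℂ) * (metricForm e (e (Φ t p).proj) a b : ℂ) := by
  set z := (Φ t p).proj
  set ξ := momForm e (Φ t p)
  set κ := ε * ham p
  have hu := e.map_source hz
  obtain ⟨C, hC, hexp⟩ := exists_shortestGeodesic_expansion he hz
  obtain ⟨K₁, hK₁, hG, hG'⟩ := exists_bound_bilinearMap (christoffel e (e z))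
  obtain ⟨K₂, hK₂, hg, hg'⟩ := exists_bound_bilinearForm (gLow e (e z))
  have hK : 0 ≤ max K₁ K₂ := hK₁.trans (le_max_left _ _)
  have hlo := isLittleO_of_forall_expansion (f := fun u => φ t (e.symm u) p) (u₀ := e z) (ξ := ξ)
    (G := fun a => christoffelForm e (e z) a a) (g := fun a => metricForm e (e z) a a)
    (κ := κ) hK hC
    (fun a b => (hG a b).trans (by gcongr; exact le_max_left _ _))
    (fun a => (hG' a).trans (by gcongr; exact le_max_left _ _))
    (fun a b => (hg a b).trans (by gcongr; exact le_max_right _ _))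
    (fun a => (hg' a).trans (by gcongr; exact le_max_right _ _)) (by
      intro η hη
      obtain ⟨ρ, hρ, hγ⟩ := hexp η hη
      have hcont : Tendsto e.symm (𝓝 (e z)) (𝓝 z) := by
        simpa [e.left_inv hz] using (e.continuousAt_symm hu).tendsto
      have hdist : ∀ᶠ x in 𝓝 z, dist z x < min ρ η := by
        have := Metric.ball_mem_nhds z (show 0 < min ρ η by positivity)
        filter_upwards [this] with x hx
        rwa [dist_comm]
      filter_upwards [e.open_target.mem_nhds hu, hcont.eventually hdist,
        hcont.eventually (hφ.eq_near t p hp)] with u hut hd ⟨c, hc, hc0, hpar, hval⟩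
      obtain ⟨h1, h2, h3⟩ := hγ _ _ hc (hd.trans_le (min_le_left _ _))
      refine ⟨_, dist z (e.symm u), dist_nonneg, (hd.trans_le (min_le_right _ _)).le, h1, h2, ?_, ?_⟩
      · rwa [e.right_inv hut] at h3
      · have h0 : (c 0).proj ∈ e.source := by rw [hc0]; exact hz
        rw [hval, integral_pairing hc.1 hpar, pairing_eq_momForm he _ h0, hc0, dist_comm]
        simp only [κ]
        push_cast
        ring)
  have h := fderiv_eq_of_isLittleO hf (ℓ := Complex.ofRealCLM.comp ξ)
    (Q := fun a => ((1 / 2 * ξ (christoffelForm e (e z) a a) : ℝ) : ℂ) +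
      Complex.I * κ / 2 * (metricForm e (e z) a a : ℂ)) (fun r a => by
        simp only [christoffelForm, metricForm, bilinearMap_smul_smul, bilinearForm_smul_smul,
          map_smul, smul_eq_mul, Complex.real_smul]
        push_cast
        ring) hlo a b
  refine ⟨h.1, h.2.trans ?_⟩
  -- Polarising gives the mixed terms in both orders; symmetry merges them and removes the factor
  -- 1/2.
  have hc1 := christoffelForm_comm (e := e) (e z) b a
  have hc2 := metricForm_comm (e := e) (e z) b a
  simp only [christoffelForm, metricForm, bilinearMap_add_add, bilinearForm_add_add, map_add]
    at hc1 hc2 ⊢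
  rw [hc1, hc2]
  push_cast
  ring

end Phase

/-! ### Critical points with parameters, and a chain rule -/

section ImplicitFunction

variable {E : Type*} [NormedAddCommGroup E] [NormedSpace ℝ E]

theorem fderiv_im {f : E → ℂ} {u : E} (hf : DifferentiableAt ℝ f u) (a : E) :
    fderiv ℝ (fun w => (f w).im) u a = (fderiv ℝ f u a).im := by
  have := Complex.imCLM.hasFDerivAt.comp u hf.hasFDerivAt
  rw [show (fun w => (f w).im) = Complex.imCLM ∘ f from rfl, this.fderiv]
  rfl

theorem fderiv_fderiv_im {f : E → ℂ} {u : E} (hf : ContDiffAt ℝ 2 f u) (a b : E) :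
    fderiv ℝ (fun w => fderiv ℝ (fun v => (f v).im) w a) u b =
      (fderiv ℝ (fun w => fderiv ℝ f w a) u b).im := by
  have hev : (fun w => fderiv ℝ (fun v => (f v).im) w a) =ᶠ[𝓝 u]
      fun w => (fderiv ℝ f w a).im := by
    filter_upwards [hf.eventually (by simp)] with w hw
    exact fderiv_im (hw.differentiableAt (by simp)) a
  have hd : DifferentiableAt ℝ (fun w => fderiv ℝ f w a) u :=
    ((hf.fderiv_right (m := 1) (by norm_num)).differentiableAt (by simp)).clm_apply
      (differentiableAt_const a)
  rw [hev.fderiv_eq, fderiv_im hd]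

/-- Nondegenerate critical points depend smoothly on parameters. -/
theorem exists_critical_point_function [FiniteDimensional ℝ E] {P : Type*} [NormedAddCommGroup P]
    [NormedSpace ℝ P] [CompleteSpace P] {G : P → E → ℝ} {q₀ : P} {u₀ : E}
    (hG : ContDiffAt ℝ 2 (Function.uncurry G) (q₀, u₀)) (hcrit : fderiv ℝ (G q₀) u₀ = 0)
    (hnd : ∀ b, b ≠ 0 → fderiv ℝ (fun w => fderiv ℝ (G q₀) w b) u₀ b ≠ 0) :
    ∃ ψ : P → E, ContDiffAt ℝ 1 ψ q₀ ∧ ψ q₀ = u₀ ∧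
      ∀ᶠ v : P × E in 𝓝 (q₀, u₀), fderiv ℝ (G v.1) v.2 = 0 → ψ v.1 = v.2 := by
  have : CompleteSpace E := FiniteDimensional.complete ℝ E
  set f : P × E → E →L[ℝ] ℝ := fun v => fderiv ℝ (G v.1) v.2
  have hf : ContDiffAt ℝ 1 f (q₀, u₀) := by
    refine ContDiffAt.fderiv (n := 2) (f := fun v : P × E => G v.1) (g := fun v => v.2) ?_
      contDiffAt_snd (by norm_num)
    have h1 : ContDiffAt ℝ 2 (fun v : (P × E) × E => (v.1.1, v.2)) ((q₀, u₀), u₀) := by fun_prop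
    exact ContDiffAt.comp ((q₀, u₀), u₀) (f := fun v : (P × E) × E => (v.1.1, v.2)) hG h1
  have hpart : HasFDerivAt (fderiv ℝ (G q₀))
      (fderiv ℝ f (q₀, u₀) ∘L ContinuousLinearMap.inr ℝ P E) u₀ := by
    have h1 : HasFDerivAt (fun u : E => (q₀, u)) (ContinuousLinearMap.inr ℝ P E) u₀ :=
      hasFDerivAt_prodMk_right q₀ u₀
    exact (hf.differentiableAt (by simp)).hasFDerivAt.comp (x := u₀) (f := fun u : E => (q₀, u)) h1
  -- The Hessian as a map from `E` to its dual is injective because its diagonal values are nonzero;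
  -- equality of dimensions makes it invertible.
  have hinj : Function.Injective (fderiv ℝ f (q₀, u₀) ∘L ContinuousLinearMap.inr ℝ P E) := by
    rw [injective_iff_map_eq_zero]
    intro b hb
    by_contra hb0
    refine hnd b hb0 ?_
    have h2 := hpart.clm_apply (hasFDerivAt_const b u₀)
    rw [h2.fderiv]
    simp [show (fderiv ℝ f (q₀, u₀)) (0, b) = 0 by simpa using hb]
  have hinv : (fderiv ℝ f (q₀, u₀) ∘L ContinuousLinearMap.inr ℝ P E).IsInvertible := by
    have hdim : Module.finrank ℝ E = Module.finrank ℝ (E →L[ℝ] ℝ) := by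
      rw [← LinearEquiv.finrank_eq (LinearMap.toContinuousLinearMap (𝕜 := ℝ) (E := E) (F' := ℝ))]
      exact (Subspace.dual_finrank_eq (K := ℝ) (V := E)).symm
    refine ⟨(LinearEquiv.ofInjectiveOfFinrankEq
      (fderiv ℝ f (q₀, u₀) ∘L ContinuousLinearMap.inr ℝ P E).toLinearMap
      hinj hdim).toContinuousLinearEquiv, ?_⟩
    ext b
    rfl
  refine ⟨hf.implicitFunction (by simp) hinv, hf.contDiffAt_implicitFunction (by simp) hinv,
    hf.implicitFunction_apply_self (by simp) hinv, ?_⟩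
  filter_upwards [hf.eventually_apply_eq_iff_implicitFunction (by simp) hinv] with v hv h0
  exact hv.1 (h0.trans hcrit.symm)

/-- The chain rule for a partial derivative along a curve. -/
theorem hasDerivAt_fderiv_along {G : ℝ → E → ℂ} {u : ℝ → E} {u' : E}
    (hG : ContDiffAt ℝ 2 (Function.uncurry G) (0, u 0)) (hu : HasDerivAt u u' 0) (a : E) :
    DifferentiableAt ℝ (fun r => fderiv ℝ (G r) (u 0) a) 0 ∧
    HasDerivAt (fun r => fderiv ℝ (G r) (u r) a)
      (deriv (fun r => fderiv ℝ (G r) (u 0) a) 0 +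
        fderiv ℝ (fun w => fderiv ℝ (G 0) w a) (u 0) u') 0 := by
  set f : ℝ × E → ℂ := fun v => fderiv ℝ (G v.1) v.2 a
  have hf : ContDiffAt ℝ 1 f (0, u 0) := by
    refine ContDiffAt.clm_apply (ContDiffAt.fderiv (n := 2) (f := fun v : ℝ × E => G v.1)
      (g := fun v => v.2) ?_ contDiffAt_snd (by norm_num)) contDiffAt_const
    have h1 : ContDiffAt ℝ 2 (fun v : (ℝ × E) × E => (v.1.1, v.2)) ((0, u 0), u 0) := by fun_prop
    exact ContDiffAt.comp ((0, u 0), u 0) (f := fun v : (ℝ × E) × E => (v.1.1, v.2)) hG h1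
  have hd := (hf.differentiableAt (by simp)).hasFDerivAt
  set L := fderiv ℝ f (0, u 0)
  have h1 : HasDerivAt (fun r => fderiv ℝ (G r) (u 0) a) (L (1, 0)) 0 :=
    hd.comp_hasDerivAt (f := fun r : ℝ => (r, u 0)) (0 : ℝ)
      ((hasDerivAt_id (0 : ℝ)).prodMk (hasDerivAt_const (0 : ℝ) (u 0)))
  have h2 : HasFDerivAt (fun w => fderiv ℝ (G 0) w a) (L ∘L ContinuousLinearMap.inr ℝ ℝ E) (u 0) :=
    hd.comp (x := u 0) (f := fun w : E => ((0 : ℝ), w)) (hasFDerivAt_prodMk_right 0 (u 0))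
  have h3 : HasDerivAt (fun r => fderiv ℝ (G r) (u r) a) (L (1, u')) 0 :=
    hd.comp_hasDerivAt (f := fun r : ℝ => (r, u r)) (0 : ℝ)
      ((hasDerivAt_id (0 : ℝ)).prodMk hu)
  refine ⟨h1.differentiableAt, h3.congr_deriv ?_⟩
  rw [h1.deriv, h2.fderiv]
  simp [← map_add]

end ImplicitFunction

/-! ### Propagation of continuity in time -/

section Propagation

/-- Continuity in the parameter `r` of a family of curves propagates along the curves, if in a
chart the family is contained in the graph of a continuous function. -/
theorem exists_continuousAt_propagation {E : Type*} [TopologicalSpace E] {M : Type*}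
    [TopologicalSpace M] [T2Space M]
    {X : ℝ → ℝ → M} (hX : ∀ᶠ r in 𝓝 (0 : ℝ), Continuous fun s => X s r)
    {e : OpenPartialHomeomorph M E} {s₀ : ℝ} (hs₀ : X s₀ 0 ∈ e.source) {ψ : ℝ × ℝ → E}
    (hψ : ∀ᶠ q in 𝓝 (s₀, (0 : ℝ)), ContinuousAt ψ q) (hψ₀ : ψ (s₀, 0) = e (X s₀ 0))
    (h : ∀ᶠ v : (ℝ × ℝ) × E in 𝓝 ((s₀, 0), e (X s₀ 0)), X v.1.1 v.1.2 ∈ e.source →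
      e (X v.1.1 v.1.2) = v.2 → ψ v.1 = v.2) :
    ∃ δ > 0, ∀ s₁ ∈ Metric.ball s₀ δ, ContinuousAt (X s₁) 0 →
      ∀ s ∈ Metric.ball s₀ δ, ContinuousAt (X s) 0 ∧
        ∀ᶠ r in 𝓝 0, X s r ∈ e.source ∧ e (X s r) = ψ (s, r) := by
  rw [nhds_prod_eq] at h
  obtain ⟨pa, ha, pb, hb, hab⟩ := eventually_prod_iff.1 h
  obtain ⟨U, hU, hUo, hu₀⟩ := mem_nhds_iff.1
    (hb.and (e.open_target.eventually_mem (e.map_source hs₀)))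
  have hψc : ContinuousAt ψ (s₀, 0) := hψ.self_of_nhds
  have hψU : ∀ᶠ q in 𝓝 (s₀, (0 : ℝ)), ψ q ∈ U :=
    hψc.eventually (hUo.mem_nhds (hψ₀ ▸ hu₀))
  obtain ⟨pc, hc, pd, hd, hcd⟩ := eventually_prod_iff.1
    (nhds_prod_eq (X := ℝ) (Y := ℝ) ▸ (ha.and (hψ.and hψU)))
  set O : Set M := e.source ∩ e ⁻¹' U
  have hO : IsOpen O := e.isOpen_inter_preimage hUo
  have hpath : ∀ᶠ s in 𝓝 s₀, X s 0 ∈ O :=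
    hX.self_of_nhds.continuousAt.eventually (hO.mem_nhds ⟨hs₀, hu₀⟩)
  obtain ⟨δ, hδ, hball⟩ := Metric.eventually_nhds_iff_ball.1 (hc.and hpath)
  refine ⟨δ, hδ, fun s₁ hs₁ hcont => ?_⟩
  have hgraph : ∀ s r, pc s → pd r → X s r ∈ O → e (X s r) = ψ (s, r) := by
    intro s r hs hr hm
    have h1 := hcd hs hr
    exact (hab h1.1 (hU hm.2).1 hm.1 rfl).symm
  -- For each small `r`, the times in the ball at which the curve lies in `O` form a relatively open
  -- and closed set containing `s₁`, hence the whole ball.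
  have hall : ∀ᶠ r in 𝓝 (0 : ℝ), ∀ s ∈ Metric.ball s₀ δ, X s r ∈ O := by
    have h1 : ∀ᶠ r in 𝓝 (0 : ℝ), X s₁ r ∈ O :=
      hcont.eventually (hO.mem_nhds (hball s₁ hs₁).2)
    filter_upwards [h1, hX, hd] with r hr1 hrX hrd
    have hopen : IsOpen {s | X s r ∈ O} := hO.preimage hrX
    refine (convex_ball s₀ δ).isPreconnected.subset_of_closure_inter_subset hopen
      ⟨s₁, hs₁, hr1⟩ ?_
    rintro s ⟨hscl, hsb⟩
    have hq := hcd (hball s hsb).1 hrd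
    have hmemU : ψ (s, r) ∈ U := hq.2.2
    have ht1 : Tendsto (fun s' => X s' r) (𝓝 s) (𝓝 (X s r)) := hrX.continuousAt
    have ht2 : Tendsto (fun s' => e.symm (ψ (s', r))) (𝓝 s) (𝓝 (e.symm (ψ (s, r)))) := by
      have h2 : ContinuousAt (fun s' => ψ (s', r)) s :=
        hq.2.1.comp (f := fun s' : ℝ => (s', r)) (by fun_prop)
      exact (e.continuousAt_symm (hU hmemU).2).comp (f := fun s' => ψ (s', r)) h2
    -- At a limit time the curve and the graph of `ψ` agree by uniqueness of limits, and `ψ` stays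
    -- in `U`, so the curve cannot leave `O`.
    have hfreq : ∃ᶠ s' in 𝓝 s, X s' r = e.symm (ψ (s', r)) := by
      have h3 := mem_closure_iff_frequently.1 hscl
      refine (h3.and_eventually (Metric.isOpen_ball.eventually_mem hsb)).mono ?_
      rintro s' ⟨hs'O, hs'b⟩
      rw [← hgraph s' r (hball s' hs'b).1 hrd hs'O, e.left_inv hs'O.1]
    have heq := tendsto_nhds_unique_of_frequently_eq ht1 ht2 hfreq
    change X s r ∈ O
    rw [heq]
    refine ⟨e.map_target (hU hmemU).2, ?_⟩
    rw [Set.mem_preimage, e.right_inv (hU hmemU).2]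
    exact hmemU
  intro s hs
  have hev : ∀ᶠ r in 𝓝 0, X s r ∈ e.source ∧ e (X s r) = ψ (s, r) := by
    filter_upwards [hall, hd] with r hr hrd
    exact ⟨(hr s hs).1, hgraph s r (hball s hs).1 hrd (hr s hs)⟩
  refine ⟨?_, hev⟩
  have hq := hcd (hball s hs).1 hd.self_of_nhds
  have h2 : ContinuousAt (fun r => ψ (s, r)) 0 :=
    hq.2.1.comp (f := fun r : ℝ => (s, r)) (by fun_prop)
  have h3 : ContinuousAt (fun r => e.symm (ψ (s, r))) 0 :=
    (e.continuousAt_symm (hU hq.2.2).2).comp (f := fun r => ψ (s, r)) h2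
  refine h3.congr ?_
  filter_upwards [hev] with r hr
  rw [← hr.2, e.left_inv hr.1]

/-- The radius `δ` does not depend on which point of the ball satisfies `p`, so `{s | p s}` is open
and closed in the connected line. -/
theorem forall_of_local_propagation {p : ℝ → Prop} {s₁ : ℝ} (h₁ : p s₁)
    (h : ∀ s₀, ∃ δ > 0, ∀ s₁ ∈ Metric.ball s₀ δ, p s₁ → ∀ s ∈ Metric.ball s₀ δ, p s) (s : ℝ) :
    p s := by
  have hclopen : IsClopen {s | p s} := by
    refine ⟨⟨?_⟩, ?_⟩
    · rw [Metric.isOpen_iff]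
      intro s₀ hs₀
      obtain ⟨δ, hδ, hp⟩ := h s₀
      exact ⟨δ, hδ, fun s hs hps => hs₀ (hp s hs hps s₀ (Metric.mem_ball_self hδ))⟩
    · rw [Metric.isOpen_iff]
      intro s₀ hs₀
      obtain ⟨δ, hδ, hp⟩ := h s₀
      exact ⟨δ, hδ, fun s hs => hp s₀ (Metric.mem_ball_self hδ) hs₀ s hs⟩
  have := hclopen.eq_univ ⟨s₁, h₁⟩
  exact Set.eq_univ_iff_forall.1 this s

end Propagation

/-! ### The phase along lines of momenta -/

section Smoothness

variable {d : ℕ} {M : Type*} [MetricSpace M] [ChartedSpace (Model d) M]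
  [IsManifold 𝓘(ℝ, Model d) ∞ M]
  [RiemannianBundle (fun x : M => TangentSpace 𝓘(ℝ, Model d) x)]
  {e : OpenPartialHomeomorph M (Model d)}
  {Φ : ℝ → CotangentBundle d M → CotangentBundle d M} {ε : ℝ}
  {φ : ℝ → M → CotangentBundle d M → ℂ}

/-- The affine line `r ↦ η + r w` in the fibre of `T*M` over `y`. -/
noncomputable def fibreLine {y : M} (η w : Cotangent d y) (r : ℝ) : CotangentBundle d M :=
  ⟨y, η + r • w⟩

/-- The base point is constant, and in a trivialisation the fibre component is affine in `r`. -/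
theorem contMDiff_fibreLine {y : M} (η w : Cotangent d y) :
    ContMDiff 𝓘(ℝ, ℝ) (𝓘(ℝ, Model d).prod 𝓘(ℝ, Model d →L[ℝ] ℝ)) ∞ (fibreLine η w) := by
  intro r₀
  refine (contMDiffAt_hom_bundle (fibreLine η w)).2 ⟨contMDiffAt_const, ?_⟩
  simp only [fibreLine, ContinuousLinearMap.inCoordinates, ContinuousLinearMap.add_comp,
    ContinuousLinearMap.comp_add, ContinuousLinearMap.smul_comp, ContinuousLinearMap.comp_smul]
  rw [contMDiffAt_iff_contDiffAt]
  fun_prop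

theorem eventually_fibreLine_ne_zero {y : M} {η : Cotangent d y} (hη : η ≠ 0)
    (w : Cotangent d y) : ∀ᶠ r in 𝓝 (0 : ℝ), (fibreLine η w r).2 ≠ 0 := by
  obtain ⟨v, hv⟩ : ∃ v, pairing η v ≠ 0 := by
    by_contra! h
    exact hη (ContinuousLinearMap.ext h)
  have hc : Continuous fun r : ℝ => pairing η v + r * pairing w v := by fun_prop
  have := (hc.continuousAt (x := 0)).eventually_ne (y := 0) (by simpa using hv)
  filter_upwards [this] with r hr h0
  apply hr
  have h1 : pairing (fibreLine η w r).2 v = 0 := by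
    rw [h0]
    rfl
  rw [← h1]
  rfl

theorem contDiffAt_phase (hφ : IsLeviCivitaPhase Φ ε φ)
    (he : e ∈ IsManifold.maximalAtlas 𝓘(ℝ, Model d) ∞ M) {y : M} {η : Cotangent d y}
    (w : Cotangent d y) {r₀ : ℝ} (hη : ∀ᶠ r in 𝓝 r₀, (fibreLine η w r).2 ≠ 0) (s₀ : ℝ)
    {u₀ : Model d} (hu : u₀ ∈ e.target) :
    ContDiffAt ℝ ∞ (fun v : (ℝ × ℝ) × Model d => φ v.1.1 (e.symm v.2) (fibreLine η w v.1.2))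
      ((s₀, r₀), u₀) := by
  rw [← contMDiffAt_iff_contDiffAt]
  have h1 : ContMDiffAt 𝓘(ℝ, (ℝ × ℝ) × Model d) 𝓘(ℝ, ℝ) ∞
      (fun v : (ℝ × ℝ) × Model d => v.1.1) ((s₀, r₀), u₀) :=
    contMDiffAt_iff_contDiffAt.2 (by fun_prop)
  have h2 : ContMDiffAt 𝓘(ℝ, (ℝ × ℝ) × Model d) 𝓘(ℝ, Model d) ∞
      (fun v : (ℝ × ℝ) × Model d => e.symm v.2) ((s₀, r₀), u₀) :=
    (contMDiffAt_symm_of_mem_maximalAtlas he hu).comp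
      (g := e.symm) (f := fun v : (ℝ × ℝ) × Model d => v.2) ((s₀, r₀), u₀)
      (contMDiffAt_iff_contDiffAt.2 contDiffAt_snd)
  have h3 : ContMDiffAt 𝓘(ℝ, (ℝ × ℝ) × Model d)
      (𝓘(ℝ, Model d).prod 𝓘(ℝ, Model d →L[ℝ] ℝ)) ∞
      (fun v : (ℝ × ℝ) × Model d => fibreLine η w v.1.2) ((s₀, r₀), u₀) :=
    (contMDiff_fibreLine η w).contMDiffAt.comp
      (f := fun v : (ℝ × ℝ) × Model d => v.1.2) ((s₀, r₀), u₀)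
      (contMDiffAt_iff_contDiffAt.2 (by fun_prop))
  have h4 := h1.prodMk (h2.prodMk h3)
  have hev : ∀ᶠ v : (ℝ × ℝ) × Model d in 𝓝 ((s₀, r₀), u₀), (fibreLine η w v.1.2).2 ≠ 0 := by
    have hc : ContinuousAt (fun v : (ℝ × ℝ) × Model d => v.1.2) ((s₀, r₀), u₀) := by fun_prop
    exact hc.eventually hη
  have h5 := (hφ.smooth (s₀, e.symm u₀, fibreLine η w r₀) hη.self_of_nhds).comp
    (s := {v : (ℝ × ℝ) × Model d | (fibreLine η w v.1.2).2 ≠ 0})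
    (f := fun v : (ℝ × ℝ) × Model d => (v.1.1, e.symm v.2, fibreLine η w v.1.2))
    ((s₀, r₀), u₀) h4.contMDiffWithinAt (fun v hv => hv)
  exact h5.contMDiffAt hev

theorem fibreLine_zero {y : M} (η w : Cotangent d y) : fibreLine η w 0 = ⟨y, η⟩ := by
  simp [fibreLine]

theorem contDiffAt_phase_space (hφ : IsLeviCivitaPhase Φ ε φ)
    (he : e ∈ IsManifold.maximalAtlas 𝓘(ℝ, Model d) ∞ M) {p : CotangentBundle d M}
    (hp : p.2 ≠ 0) (t : ℝ) {u₀ : Model d} (hu : u₀ ∈ e.target) :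
    ContDiffAt ℝ 2 (fun u => φ t (e.symm u) p) u₀ := by
  have h1 : ContDiffAt ℝ 2 (fun u : Model d => (((t, (0 : ℝ)), u) : (ℝ × ℝ) × Model d)) u₀ := by
    fun_prop
  -- With direction 0 the line of momenta is constant.
  have h2 := (contDiffAt_infty.1 (contDiffAt_phase hφ he (0 : Cotangent d p.proj)
    (eventually_fibreLine_ne_zero hp 0) t hu) 2).comp u₀
      (f := fun u : Model d => (((t, (0 : ℝ)), u) : (ℝ × ℝ) × Model d)) h1
  simp only [Function.comp_def, fibreLine_zero] at h2
  exact h2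

end Smoothness

/-! ### Differentiability of the flow from the phase -/

section Flow

variable {d : ℕ} {M : Type*} [MetricSpace M] [ChartedSpace (Model d) M]
  [IsManifold 𝓘(ℝ, Model d) ∞ M]
  [RiemannianBundle (fun x : M => TangentSpace 𝓘(ℝ, Model d) x)]
  [IsContMDiffRiemannianBundle 𝓘(ℝ, Model d) ∞ (Model d)
      (fun x : M => TangentSpace 𝓘(ℝ, Model d) x)]
  [IsRiemannianManifold 𝓘(ℝ, Model d) M]
  {e : OpenPartialHomeomorph M (Model d)}
  {Φ : ℝ → CotangentBundle d M → CotangentBundle d M} {ε : ℝ}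
  {φ : ℝ → M → CotangentBundle d M → ℂ}

/-- The points `x*` are, locally, the critical points of the imaginary part of the phase. -/
theorem exists_local_representation (hΦ : IsCogeodesicFlow Φ) (hε : 0 < ε)
    (hφ : IsLeviCivitaPhase Φ ε φ)
    (he : e ∈ IsManifold.maximalAtlas 𝓘(ℝ, Model d) ∞ M) {y : M} {η : Cotangent d y}
    (hη : η ≠ 0) (w : Cotangent d y) {s₀ : ℝ} (hs₀ : (Φ s₀ ⟨y, η⟩).proj ∈ e.source) :
    ∃ ψ : ℝ × ℝ → Model d, ContDiffAt ℝ 1 ψ (s₀, 0) ∧ ∃ δ > 0, ∀ s₁ ∈ Metric.ball s₀ δ,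
      ContinuousAt (fun r => (Φ s₁ (fibreLine η w r)).proj) 0 → ∀ s ∈ Metric.ball s₀ δ,
        ContinuousAt (fun r => (Φ s (fibreLine η w r)).proj) 0 ∧
        ∀ᶠ r in 𝓝 0, (Φ s (fibreLine η w r)).proj ∈ e.source ∧
          e (Φ s (fibreLine η w r)).proj = ψ (s, r) := by
  have hne := eventually_fibreLine_ne_zero hη w
  rw [← fibreLine_zero η w] at hs₀
  have hu := e.map_source hs₀
  set u₀ := e (Φ s₀ (fibreLine η w 0)).proj with hu₀
  -- The gradient of the phase at `x*` is the real covector `ξ*`, so its imaginary part vanishes.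
  have hgrad : ∀ (s r : ℝ), (fibreLine η w r).2 ≠ 0 → (Φ s (fibreLine η w r)).proj ∈ e.source →
      fderiv ℝ (fun u => (φ s (e.symm u) (fibreLine η w r)).im)
        (e (Φ s (fibreLine η w r)).proj) = 0 := by
    intro s r hr hs
    have hf := contDiffAt_phase_space hφ he hr s (e.map_source hs)
    ext a
    rw [fderiv_im (hf.differentiableAt (by simp)), (fderiv_phase_eq hφ s hr he hs hf a a).1]
    simp
  obtain ⟨ψ, hψ, hψ₀, hψe⟩ := exists_critical_point_function (E := Model d) (P := ℝ × ℝ)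
    (G := fun q u => (φ q.1 (e.symm u) (fibreLine η w q.2)).im) (q₀ := (s₀, 0)) (u₀ := u₀)
    (Complex.imCLM.contDiff.contDiffAt.comp ((s₀, (0 : ℝ)), u₀)
      (contDiffAt_infty.1 (contDiffAt_phase hφ he w hne s₀ hu) 2))
    (hgrad s₀ 0 hne.self_of_nhds hs₀) (by
      intro b hb
      have hf := contDiffAt_phase_space hφ he hne.self_of_nhds s₀ hu
      rw [fderiv_fderiv_im hf, (fderiv_phase_eq hφ s₀ hne.self_of_nhds he hs₀ hf b b).2]
      have h1 := metricForm_pos he hu hb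
      have h2 := ham_pos hne.self_of_nhds
      simp only [Complex.add_im, Complex.ofReal_im, Complex.mul_im, Complex.mul_re, Complex.I_re,
        Complex.I_im, Complex.ofReal_re]
      have h3 := mul_pos (mul_pos hε h2) h1
      simp only [zero_add, mul_zero, zero_mul, one_mul, sub_zero]
      exact h3.ne')
  refine ⟨ψ, hψ, exists_continuousAt_propagation
    (X := fun s r => (Φ s (fibreLine η w r)).proj) ?_ hs₀ ?_ hψ₀ ?_⟩
  · filter_upwards [hne] with r hr
    exact (FiberBundle.continuous_proj (Model d →L[ℝ] ℝ) (fun x : M => Cotangent d x)).comp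
      (hΦ _ hr).1.1
  · filter_upwards [hψ.eventually (by simp)] with q hq using hq.continuousAt
  · have hne' : ∀ᶠ v : (ℝ × ℝ) × Model d in 𝓝 ((s₀, (0 : ℝ)), u₀),
        (fibreLine η w v.1.2).2 ≠ 0 := by
      have hc : ContinuousAt (fun v : (ℝ × ℝ) × Model d => v.1.2) ((s₀, (0 : ℝ)), u₀) := by
        fun_prop
      exact hc.eventually hne
    filter_upwards [hψe, hne'] with v hv hvne hvs hvu
    apply hv
    rw [← hvu]
    exact hgrad _ _ hvne hvs

/-- The points `x*` depend continuously on the momentum `η`. -/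
theorem continuousAt_flow_proj (hΦ : IsCogeodesicFlow Φ) (hε : 0 < ε)
    (hφ : IsLeviCivitaPhase Φ ε φ) {y : M} {η : Cotangent d y} (hη : η ≠ 0)
    (w : Cotangent d y) (s : ℝ) :
    ContinuousAt (fun r => (Φ s (fibreLine η w r)).proj) 0 := by
  refine forall_of_local_propagation
    (p := fun s => ContinuousAt (fun r => (Φ s (fibreLine η w r)).proj) 0) (s₁ := 0) ?_ ?_ s
  -- At time 0 the base point is `y` for every momentum.
  · refine continuousAt_const (y := y) |>.congr ?_
    filter_upwards [eventually_fibreLine_ne_zero hη w] with r hr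
    rw [(hΦ _ hr).2]
    rfl
  · intro s₀
    obtain ⟨ψ, -, δ, hδ, h⟩ := exists_local_representation hΦ hε hφ
      (IsManifold.chart_mem_maximalAtlas (Φ s₀ ⟨y, η⟩).proj) hη w (mem_chart_source _ _)
    exact ⟨δ, hδ, fun s₁ hs₁ hc s hs => (h s₁ hs₁ hc s hs).1⟩

theorem differentiableAt_flow_proj (hΦ : IsCogeodesicFlow Φ) (hε : 0 < ε)
    (hφ : IsLeviCivitaPhase Φ ε φ)
    (he : e ∈ IsManifold.maximalAtlas 𝓘(ℝ, Model d) ∞ M) {y : M} {η : Cotangent d y}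
    (hη : η ≠ 0) (w : Cotangent d y) {t : ℝ} (ht : (Φ t ⟨y, η⟩).proj ∈ e.source) :
    DifferentiableAt ℝ (fun r => e (Φ t (fibreLine η w r)).proj) 0 := by
  obtain ⟨ψ, hψ, δ, hδ, h⟩ := exists_local_representation hΦ hε hφ he hη w ht
  have hb := Metric.mem_ball_self (x := t) hδ
  have hev := (h t hb (continuousAt_flow_proj hΦ hε hφ hη w t) t hb).2
  have h1 : DifferentiableAt ℝ (fun r : ℝ => ψ (t, r)) 0 :=
    (hψ.differentiableAt (by simp)).comp (f := fun r : ℝ => (t, r)) (0 : ℝ) (by fun_prop)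
  exact h1.congr_of_eventuallyEq (hev.mono fun r hr => hr.2)

/-- The derivatives of `x*`, `ξ*` and `φ_x` along a line in the cotangent space `T*_y M`. -/
theorem exists_hasDerivAt_phase (hΦ : IsCogeodesicFlow Φ) (hε : 0 < ε)
    (hφ : IsLeviCivitaPhase Φ ε φ)
    (he : e ∈ IsManifold.maximalAtlas 𝓘(ℝ, Model d) ∞ M) {y : M} {η : Cotangent d y}
    (hη : η ≠ 0) (w : Cotangent d y) {t : ℝ} (ht : (Φ t ⟨y, η⟩).proj ∈ e.source) :
    ∃ (x' : Model d) (m' : Fin d → ℝ),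
      HasDerivAt (fun r => e (Φ t (fibreLine η w r)).proj) x' 0 ∧
      (∀ β, HasDerivAt (fun r => momCoord e (Φ t (fibreLine η w r)) β) (m' β) 0) ∧
      ∀ α, HasDerivAt (fun r => partialD (fun v => φ t (e.symm v) (fibreLine η w r)) α
        (e (Φ t ⟨y, η⟩).proj))
        ((m' α : ℂ) - ((momForm e (Φ t ⟨y, η⟩) (christoffelForm e (e (Φ t ⟨y, η⟩).proj)
            (EuclideanSpace.single α 1) x') : ℂ) +
          Complex.I * ((ε * ham (⟨y, η⟩ : CotangentBundle d M) : ℝ) : ℂ) *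
            (metricForm e (e (Φ t ⟨y, η⟩).proj) (EuclideanSpace.single α 1) x' : ℂ))) 0 := by
  have hne := eventually_fibreLine_ne_zero hη w
  have hx := (differentiableAt_flow_proj hΦ hε hφ he hη w ht).hasDerivAt
  set x' := deriv (fun r => e (Φ t (fibreLine η w r)).proj) 0
  have hu := e.map_source ht
  set u : ℝ → Model d := fun r => e (Φ t (fibreLine η w r)).proj with hudef
  have hu0 : u 0 = e (Φ t ⟨y, η⟩).proj := by simp only [hudef, fibreLine_zero]
  set G : ℝ → Model d → ℂ := fun r v => φ t (e.symm v) (fibreLine η w r) with hGdef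
  have hG0 : G 0 = fun v => φ t (e.symm v) ⟨y, η⟩ := by simp only [hGdef, fibreLine_zero]
  have hG : ContDiffAt ℝ 2 (Function.uncurry G) (0, u 0) := by
    rw [hu0]
    have h1 : ContDiffAt ℝ 2 (fun v : ℝ × Model d => (((t, v.1), v.2) : (ℝ × ℝ) × Model d))
      (0, e (Φ t ⟨y, η⟩).proj) := by fun_prop
    exact (contDiffAt_infty.1 (contDiffAt_phase hφ he w hne t hu) 2).comp
      (f := fun v : ℝ × Model d => (((t, v.1), v.2) : (ℝ × ℝ) × Model d)) _ h1
  have hsrc : ∀ᶠ r in 𝓝 (0 : ℝ), (Φ t (fibreLine η w r)).proj ∈ e.source :=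
    (continuousAt_flow_proj hΦ hε hφ hη w t).eventually
      (e.open_source.mem_nhds (by simpa only [fibreLine_zero] using ht))
  -- The identity `φ_x = ξ*` at `x*`, for all nearby momenta; this is what gets differentiated.
  have hmom : ∀ a, (fun r => fderiv ℝ (G r) (u r) a) =ᶠ[𝓝 0]
      fun r => ((momForm e (Φ t (fibreLine η w r)) a : ℝ) : ℂ) := by
    intro a
    filter_upwards [hne, hsrc] with r hr hrs
    exact (fderiv_phase_eq hφ t hr he hrs
      (contDiffAt_phase_space hφ he hr t (e.map_source hrs)) a a).1
  have hf := contDiffAt_phase_space hφ he (p := ⟨y, η⟩) hη t hu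
  have hchain : ∀ α, HasDerivAt
      (fun r => ((momForm e (Φ t (fibreLine η w r)) (EuclideanSpace.single α 1) : ℝ) : ℂ)) _ 0 :=
    fun α => (hasDerivAt_fderiv_along (E := Model d) hG hx
      (EuclideanSpace.single α 1)).2.congr_of_eventuallyEq (hmom _).symm
  -- Differentiability of `ξ*` is inherited from that of `φ_x` at `x*`; the real part returns from
  -- complex to real values.
  have hreal : ∀ α, HasDerivAt (fun r => momCoord e (Φ t (fibreLine η w r)) α)
      (deriv (fun r => momCoord e (Φ t (fibreLine η w r)) α) 0) 0 := by
    intro α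
    have h1 := Complex.reCLM.hasFDerivAt.comp_hasDerivAt (0 : ℝ) (hchain α)
    have h2 : DifferentiableAt ℝ (fun r => momCoord e (Φ t (fibreLine η w r)) α) 0 := by
      refine h1.differentiableAt.congr_of_eventuallyEq (Eventually.of_forall fun r => ?_)
      simp [momForm_single]
    exact h2.hasDerivAt
  refine ⟨x', fun α => deriv (fun r => momCoord e (Φ t (fibreLine η w r)) α) 0, hx, hreal, ?_⟩
  intro α
  -- Two expressions for the same derivative: `φ_{xη} + φ_{xx} x' = m'`.
  have h1 := (hchain α).unique (by
    simp only [momForm_single]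
    exact (hreal α).ofReal_comp)
  have h2 := (hasDerivAt_fderiv_along (E := Model d) hG hx
    (EuclideanSpace.single α 1)).1.hasDerivAt
  rw [hG0, hu0, (fderiv_phase_eq hφ t (p := ⟨y, η⟩) hη he ht hf _ _).2] at h1
  rw [← h1, add_sub_cancel_right]
  rw [hu0] at h2
  refine h2.congr_of_eventuallyEq ?_
  filter_upwards [hne] with r hr
  exact partialD_eq_fderiv ((contDiffAt_phase_space hφ he hr t hu).differentiableAt (by simp)) α

end Flow

end LeviCivitaPhase

/-! ### The mixed derivative in index notation -/

open LeviCivitaPhase in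
theorem theorem10p2 (d : ℕ) (hd : 2 ≤ d) {M : Type*} [MetricSpace M]
    [ChartedSpace (LeviCivitaPhase.Model d) M]
    [IsManifold 𝓘(ℝ, LeviCivitaPhase.Model d) ∞ M]
    [RiemannianBundle (fun x : M => TangentSpace 𝓘(ℝ, LeviCivitaPhase.Model d) x)]
    [IsContMDiffRiemannianBundle 𝓘(ℝ, LeviCivitaPhase.Model d) ∞ (LeviCivitaPhase.Model d)
      (fun x : M => TangentSpace 𝓘(ℝ, LeviCivitaPhase.Model d) x)]
    [IsRiemannianManifold 𝓘(ℝ, LeviCivitaPhase.Model d) M]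
    [CompactSpace M] [ConnectedSpace M]
    (Φ : ℝ → LeviCivitaPhase.CotangentBundle d M → LeviCivitaPhase.CotangentBundle d M)
    (hΦ : LeviCivitaPhase.IsCogeodesicFlow Φ)
    (ε : ℝ) (hε : 0 < ε)
    (φ : ℝ → M → LeviCivitaPhase.CotangentBundle d M → ℂ)
    (hφ : LeviCivitaPhase.IsLeviCivitaPhase Φ ε φ)
    (t : ℝ) (y : M) (η : LeviCivitaPhase.Cotangent d y) (hη : η ≠ 0)
    (e e' : OpenPartialHomeomorph M (LeviCivitaPhase.Model d))
    (he : e ∈ IsManifold.maximalAtlas 𝓘(ℝ, LeviCivitaPhase.Model d) ∞ M)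
    (he' : e' ∈ IsManifold.maximalAtlas 𝓘(ℝ, LeviCivitaPhase.Model d) ∞ M)
    (hx : (Φ t ⟨y, η⟩).proj ∈ e.source) (hy : y ∈ e'.source) (α μ : Fin d) :
    (∀ β : Fin d,
      LeviCivitaPhase.EtaDifferentiableAt e' (LeviCivitaPhase.xStar e Φ t y β) μ η ∧
      LeviCivitaPhase.EtaDifferentiableAt e' (LeviCivitaPhase.xiStar e Φ t y β) μ η) ∧
    LeviCivitaPhase.EtaDifferentiableAt e'
      (LeviCivitaPhase.phiX e φ t y α (e (Φ t ⟨y, η⟩).proj)) μ η ∧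
    LeviCivitaPhase.etaD e'
        (LeviCivitaPhase.phiX e φ t y α (e (Φ t ⟨y, η⟩).proj)) μ η =
      ∑ β, (LeviCivitaPhase.gLow e (e (Φ t ⟨y, η⟩).proj) α β : ℂ) *
        ((LeviCivitaPhase.p e e' Φ t y η β μ : ℂ)
          - Complex.I * ε * LeviCivitaPhase.ham (⟨y, η⟩ : LeviCivitaPhase.CotangentBundle d M)
            * (LeviCivitaPhase.q e e' Φ t y η β μ : ℂ)) := by
  obtain ⟨x', m', hx', hm', hph⟩ :=
    exists_hasDerivAt_phase hΦ hε hφ he hη (coordCovec e' y μ) hx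
  have hxc : ∀ β, HasDerivAt (fun r : ℝ => xStar e Φ t y β (η + r • coordCovec e' y μ))
      (x' β) 0 := fun β => hasDerivAt_coord hx' β
  have hq : ∀ β, q e e' Φ t y η β μ = x' β := fun β => (hxc β).deriv
  have hxi : ∀ β, etaD e' (xiStar e Φ t y β) μ η = m' β := fun β => (hm' β).deriv
  have hu := e.map_source hx
  refine ⟨fun β => ⟨(hxc β).differentiableAt, (hm' β).differentiableAt⟩,
    (hph α).differentiableAt, (hph α).deriv.trans ?_⟩
  -- Lowering the index cancels the inverse metric in the definition of `p`.
  have hp : ∑ β, gLow e (e (Φ t ⟨y, η⟩).proj) α β * p e e' Φ t y η β μ = m' α -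
      ∑ ρ, ∑ β, christoffel e (e (Φ t ⟨y, η⟩).proj) ρ α β * xiStar e Φ t y ρ η * x' β := by
    refine (sum_gLow_mul_gUp he hu _ α).trans ?_
    rw [hxi]
    congr 1
    exact Finset.sum_congr rfl fun ρ _ => Finset.sum_congr rfl fun β _ => by rw [← hq]; rfl
  have hΓ : momForm e (Φ t ⟨y, η⟩) (christoffelForm e (e (Φ t ⟨y, η⟩).proj)
      (EuclideanSpace.single α 1) x') =
      ∑ ρ, ∑ β, christoffel e (e (Φ t ⟨y, η⟩).proj) ρ α β * xiStar e Φ t y ρ η * x' β := by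
    rw [momForm_apply]
    refine Finset.sum_congr rfl fun ρ _ => ?_
    rw [christoffelForm_apply, Finset.sum_eq_single α, Finset.mul_sum]
    · refine Finset.sum_congr rfl fun β _ => ?_
      simp only [PiLp.single_apply, if_true, xiStar]
      ring
    · intro γ _ hγ
      simp [hγ]
    · simp
  have hg : metricForm e (e (Φ t ⟨y, η⟩).proj) (EuclideanSpace.single α 1) x' =
      ∑ β, gLow e (e (Φ t ⟨y, η⟩).proj) α β * q e e' Φ t y η β μ := by
    rw [metricForm_apply, Finset.sum_eq_single α]
    · simp [hq]
    · intro γ _ hγ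
      simp [hγ]
    · simp
  have hsplit : ∑ β, (gLow e (e (Φ t ⟨y, η⟩).proj) α β : ℂ) *
      ((p e e' Φ t y η β μ : ℂ) - Complex.I * ε * ham (⟨y, η⟩ : CotangentBundle d M) *
        (q e e' Φ t y η β μ : ℂ)) =
      ((∑ β, gLow e (e (Φ t ⟨y, η⟩).proj) α β * p e e' Φ t y η β μ : ℝ) : ℂ) -
      Complex.I * ε * ham (⟨y, η⟩ : CotangentBundle d M) *
        ((∑ β, gLow e (e (Φ t ⟨y, η⟩).proj) α β * q e e' Φ t y η β μ : ℝ) : ℂ) := by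
    push_cast
    rw [Finset.mul_sum, ← Finset.sum_sub_distrib]
    exact Finset.sum_congr rfl fun β _ => by ring
  rw [hsplit, hp, ← hΓ, ← hg]
  push_cast
  ring
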